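/- Let $m\ge 1$ be an integer. There is a constant $c=c(m)>0$, depending only on $m$, such that the following holds for every integer $r\ge 0$ with $m\ge r+1$. Let $x_0\le x_1\le\dots\le x_m$ be real numbers with $x_j<x_{j+r+1}$ for all $0\le j\le m-r-1$ (that is, each point has multiplicity at most $r+1$), and let $f\in C^{(r)}[x_0,x_m]$ be real valued. Then $$\bigl|[x_0,\dots,x_m;f]\bigr|\le c\,\Lambda_r(x_0,\dots,x_m;\omega_k),\qquad k:=m-r,\quad \omega_k(t):=\omega_k(f^{(r)},t;[x_0,x_m]).$$ Here the following notation is used. The Lagrange–Hermite divided difference is defined recursively by $[y_0;f]:=f(y_0)$ and, for $n\ge 1$, by $[y_0,\dots,y_n;f]:=f^{(n)}(y_0)/n!$ if $y_0=\dots=y_n$, and otherwise by $$[y_0,\dots,y_n;f]:=\frac{[y_1,\dots,y_n;f]-[y_0,\dots,y_{j-1},y_{j+1},\dots,y_n;f]}{y_j-y_0}$$ for any $j$ with $y_j\ne y_0$ (the value does not depend on the choice of $j$); derivatives at the endpoints of $[x_0,x_m]$ are one-sided. For $g\in C[a,b]$, $k\in\mathbb N$ and $u>0$, put $\Delta_u^k(g,x;[a,b]):=\sum_{i=0}^k(-1)^i\binom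 ki g\bigl(x+(k/2-i)u\bigr)$ if $x\pm (k/2)u\in[a,b]$ and $\Delta_u^k(g,x;[a,b]):=0$ otherwise; the $k$-th modulus of smoothness is $$\omega_k(g,t;[a,b]):=\sup_{0<u\le t}\ \sup_{x\in[a,b]}|\Delta_u^k(g,x;[a,b])|,\qquad \omega_k(g,0;[a,b]):=0.$$ Put $x_{-1}:=x_0-(x_m-x_0)$, $x_{m+1}:=x_m+(x_m-x_0)$ and, for integers $0\le p,q\le m$ with $q-p\ge r+1$, $d(p,q):=\min\{x_{q+1}-x_p,\;x_q-x_{p-1}\}$ and $$\Lambda_{p,q,r}(x_0,\dots,x_m;\varphi):=\frac{\displaystyle\int_{x_q-x_p}^{d(p,q)}u^{p+r-q-1}\varphi(u)\,du}{\displaystyle\prod_{i=0}^{p-1}(x_q-x_i)\prod_{i=q+1}^{m}(x_i-x_p)},$$ where empty products equal $1$. Finally, $$\Lambda_r(x_0,\dots,x_m;\varphi):=\max\{\Lambda_{p,q,r}(x_0,\dots,x_m;\varphi):\ 0\le p,q\le m,\ q-p\ge r+1\}.$$ -/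

import Mathlib

open Set

noncomputable section

/-- The Lagrange–Hermite divided difference `[x₀, …, x_m; f]` of a function `f` on the domain `S`.
Derivatives of `f` are taken within `S` (one-sided at the endpoints of a closed interval).
If the knots do not all coincide, the recursion is applied with the largest index `j` such that
`x_j ≠ x₀`; the knots obtained by deleting `x₀` and by deleting `x_j` are
`fun i => x i.succ` and `fun i => x (j.succAbove i)`. -/
def dividedDifference (S : Set ℝ) (f : ℝ → ℝ) : (m : ℕ) → (Fin (m + 1) → ℝ) → ℝ
  | 0, x => f (x 0)
  | m + 1, x =>
    if h : (Finset.univ.filter fun j : Fin (m + 2) => x j ≠ x 0).Nonempty then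
      (dividedDifference S f m (fun i => x i.succ)
          - dividedDifference S f m
              (fun i => x ((Finset.max' _ h).succAbove i)))
        / (x (Finset.max' _ h) - x 0)
    else iteratedDerivWithin (m + 1) f S (x 0) / ((m + 1).factorial : ℝ)

open Classical in
/-- The symmetric difference `Δ^k_u(g, x; [a,b])` of order `k` with step `u`. -/
def symmDifference (k : ℕ) (u : ℝ) (g : ℝ → ℝ) (x a b : ℝ) : ℝ :=
  if x - (k : ℝ) / 2 * u ∈ Icc a b ∧ x + (k : ℝ) / 2 * u ∈ Icc a b then
    ∑ i ∈ Finset.range (k + 1),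
      (-1 : ℝ) ^ i * (k.choose i : ℝ) * g (x + ((k : ℝ) / 2 - (i : ℝ)) * u)
  else 0

/-- The `k`-th modulus of smoothness `ω_k(g, t; [a,b])`: the supremum of `|Δ^k_u(g, x; [a,b])|`
over `0 < u ≤ t` and `x ∈ [a,b]`. It is `0` for `t = 0`. -/
def modulusOfSmoothness (k : ℕ) (g : ℝ → ℝ) (a b t : ℝ) : ℝ :=
  sSup {y : ℝ | ∃ u ∈ Ioc (0 : ℝ) t, ∃ x ∈ Icc a b, y = |symmDifference k u g x a b|}

/-- The set `Q_{m,r}` of pairs of indices `(p, q)` with `q - p ≥ r + 1`. -/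
def indexPairs (m r : ℕ) : Finset (Fin (m + 1) × Fin (m + 1)) :=
  Finset.univ.filter fun pq => (pq.1 : ℕ) + r + 1 ≤ (pq.2 : ℕ)

theorem indexPairs_nonempty {m r : ℕ} (h : r + 1 ≤ m) : (indexPairs m r).Nonempty :=
  ⟨(0, Fin.last m), by simp [indexPairs]; omega⟩

/-- The knot `x_{p-1}`, where `x_{-1} := x₀ - (x_m - x₀)`. -/
def prevKnot {m : ℕ} (x : Fin (m + 1) → ℝ) (p : Fin (m + 1)) : ℝ :=
  if (p : ℕ) = 0 then x 0 - (x (Fin.last m) - x 0)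
  else x ⟨(p : ℕ) - 1, by omega⟩

/-- The knot `x_{q+1}`, where `x_{m+1} := x_m + (x_m - x₀)`. -/
def nextKnot {m : ℕ} (x : Fin (m + 1) → ℝ) (q : Fin (m + 1)) : ℝ :=
  if h : (q : ℕ) + 1 < m + 1 then x ⟨(q : ℕ) + 1, h⟩
  else x (Fin.last m) + (x (Fin.last m) - x 0)

/-- `d(p,q) = min {x_{q+1} - x_p, x_q - x_{p-1}}`. -/
def knotGap {m : ℕ} (x : Fin (m + 1) → ℝ) (p q : Fin (m + 1)) : ℝ :=
  min (nextKnot x q - x p) (x q - prevKnot x p)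

/-- The quantity `Λ_{p,q,r}(x₀, …, x_m; φ)`. -/
def lambdaPair {m : ℕ} (r : ℕ) (x : Fin (m + 1) → ℝ) (φ : ℝ → ℝ) (p q : Fin (m + 1)) : ℝ :=
  (∫ u in (x q - x p)..(knotGap x p q), u ^ ((p : ℤ) + (r : ℤ) - (q : ℤ) - 1) * φ u)
    / ((∏ i ∈ Finset.Iio p, (x q - x i)) * ∏ i ∈ Finset.Ioi q, (x i - x p))

/-- `Λ_r(x₀, …, x_m; φ)`, the maximum of `Λ_{p,q,r}(x₀, …, x_m; φ)` over `(p,q) ∈ Q_{m,r}`. -/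
def lambdaMax {m r : ℕ} (h : r + 1 ≤ m) (x : Fin (m + 1) → ℝ) (φ : ℝ → ℝ) : ℝ :=
  (indexPairs m r).sup' (indexPairs_nonempty h) fun pq => lambdaPair r x φ pq.1 pq.2

end

open Polynomial

theorem Polynomial.contDiff_eval (P : ℝ[X]) {n : WithTop ℕ∞} :
    ContDiff ℝ n (fun t => P.eval t) := by
  simpa [aeval_def, eval₂_eq_eval_map] using P.contDiff_aeval (𝕜 := ℝ) n

theorem iteratedDerivWithin_polynomial_eval {S : Set ℝ} (hS : UniqueDiffOn ℝ S) (P : ℝ[X]) (n : ℕ)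
    {y : ℝ} (hy : y ∈ S) :
    iteratedDerivWithin n (fun t => P.eval t) S y = (derivative^[n] P).eval y := by
  rw [iteratedDerivWithin_eq_iteratedDeriv hS P.contDiff_eval.contDiffAt hy]
  induction n generalizing P with
  | zero => simp
  | succ n ih =>
    rw [iteratedDeriv_succ', Function.iterate_succ_apply, ← ih]
    congr 1
    ext t
    exact P.deriv

theorem dividedDifference_of_lt (S : Set ℝ) (f : ℝ → ℝ) {n : ℕ} {x : Fin (n + 2) → ℝ}
    (h : x 0 < x (Fin.last (n + 1))) :
    dividedDifference S f (n + 1) x =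
      (dividedDifference S f n (fun i => x i.succ) - dividedDifference S f n (fun i => x i.castSucc))
        / (x (Fin.last (n + 1)) - x 0) := by
  have hmem : Fin.last (n + 1) ∈ Finset.univ.filter fun j : Fin (n + 2) => x j ≠ x 0 := by
    simp [h.ne']
  have hne : (Finset.univ.filter fun j : Fin (n + 2) => x j ≠ x 0).Nonempty := ⟨_, hmem⟩
  have hmax : Finset.max' _ hne = Fin.last (n + 1) :=
    le_antisymm (Fin.le_last _) (Finset.le_max' _ _ hmem)
  rw [dividedDifference, dif_pos hne, hmax]
  simp only [Fin.succAbove_last]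

theorem dividedDifference_of_eq (S : Set ℝ) (f : ℝ → ℝ) {n : ℕ} {x : Fin (n + 1) → ℝ}
    (h : ∀ j, x j = x 0) :
    dividedDifference S f n x = iteratedDerivWithin n f S (x 0) / (n.factorial : ℝ) := by
  cases n with
  | zero => simp [dividedDifference]
  | succ n =>
    rw [dividedDifference, dif_neg]
    simp [h]

theorem Monotone.fin_lt_or_forall_eq {n : ℕ} {x : Fin (n + 1) → ℝ} (hx : Monotone x) :
    x 0 < x (Fin.last n) ∨ ∀ j, x j = x 0 := by
  rcases (hx (Fin.zero_le (Fin.last n))).lt_or_eq with h | h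
  · exact Or.inl h
  · exact Or.inr fun j => le_antisymm ((hx (Fin.le_last j)).trans h.ge) (hx (Fin.zero_le j))

/-- Linearity of divided differences under subtraction, for knots of multiplicity at most `r + 1`
and functions of class `C^r`. -/
theorem dividedDifference_sub {S : Set ℝ} (hS : UniqueDiffOn ℝ S) {r : ℕ} {f g : ℝ → ℝ}
    (hf : ContDiffOn ℝ r f S) (hg : ContDiffOn ℝ r g S) {n : ℕ} {x : Fin (n + 1) → ℝ}
    (hx : Monotone x) (hxS : ∀ i, x i ∈ S)
    (hmul : ∀ i j : Fin (n + 1), (j : ℕ) = (i : ℕ) + r + 1 → x i < x j) :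
    dividedDifference S (fun t => f t - g t) n x =
      dividedDifference S f n x - dividedDifference S g n x := by
  induction n with
  | zero => simp [dividedDifference]
  | succ n ih =>
    rcases hx.fin_lt_or_forall_eq with h | h
    · rw [dividedDifference_of_lt _ _ h, dividedDifference_of_lt _ _ h,
        dividedDifference_of_lt _ _ h, ih, ih]
      · ring
      · exact fun i j hij => hx (Fin.castSucc_le_castSucc_iff.2 hij)
      · exact fun i => hxS _
      · exact fun i j hij => hmul _ _ (by simpa using hij)
      · exact fun i j hij => hx (Fin.succ_le_succ_iff.2 hij)
      · exact fun i => hxS _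
      · exact fun i j hij => hmul _ _ (by simp; omega)
    · have hn : n + 1 ≤ r := by
        by_contra hlt
        have := hmul 0 ⟨r + 1, by omega⟩ (by simp)
        rw [h ⟨r + 1, by omega⟩] at this
        exact lt_irrefl _ this
      have hle : ((n + 1 : ℕ) : WithTop ℕ∞) ≤ (r : ℕ) := by exact_mod_cast hn
      rw [dividedDifference_of_eq _ _ h, dividedDifference_of_eq _ _ h,
        dividedDifference_of_eq _ _ h, ← sub_div]
      congr 1
      exact iteratedDerivWithin_sub (hxS 0) hS ((hf.of_le hle) _ (hxS 0)) ((hg.of_le hle) _ (hxS 0))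

/-- `dividedDifference_sub` without restriction on the multiplicities. -/
theorem dividedDifference_sub_of_contDiffOn {S : Set ℝ} (hS : UniqueDiffOn ℝ S) {f g : ℝ → ℝ}
    {n : ℕ} (hf : ContDiffOn ℝ n f S) (hg : ContDiffOn ℝ n g S) {x : Fin (n + 1) → ℝ}
    (hx : Monotone x) (hxS : ∀ i, x i ∈ S) :
    dividedDifference S (fun t => f t - g t) n x =
      dividedDifference S f n x - dividedDifference S g n x :=
  dividedDifference_sub hS hf hg hx hxS fun i j h => by omega


theorem dividedDifference_const_mul (S : Set ℝ) (a : ℝ) (f : ℝ → ℝ)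
    {n : ℕ} {x : Fin (n + 1) → ℝ} (hx : Monotone x) :
    dividedDifference S (fun t => a * f t) n x = a * dividedDifference S f n x := by
  induction n with
  | zero => simp [dividedDifference]
  | succ n ih =>
    rcases hx.fin_lt_or_forall_eq with h | h
    · rw [dividedDifference_of_lt _ _ h, dividedDifference_of_lt _ _ h, ih, ih]
      · ring
      · exact fun i j hij => hx (Fin.castSucc_le_castSucc_iff.2 hij)
      · exact fun i j hij => hx (Fin.succ_le_succ_iff.2 hij)
    · rw [dividedDifference_of_eq _ _ h, dividedDifference_of_eq _ _ h,
        iteratedDerivWithin_const_mul_field]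
      ring

theorem dividedDifference_tail_sub_init (S : Set ℝ) (f : ℝ → ℝ) {n : ℕ} {x : Fin (n + 2) → ℝ}
    (hx : Monotone x) :
    dividedDifference S f n (fun i => x i.succ) - dividedDifference S f n (fun i => x i.castSucc) =
      (x (Fin.last (n + 1)) - x 0) * dividedDifference S f (n + 1) x := by
  rcases hx.fin_lt_or_forall_eq with h | h
  · rw [dividedDifference_of_lt _ _ h, mul_div_cancel₀ _ (sub_ne_zero.2 h.ne')]
  · have : (fun i : Fin (n + 1) => x i.succ) = fun i => x i.castSucc := by
      ext i; rw [h, h i.castSucc]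
    rw [this, h (Fin.last (n + 1))]
    simp

theorem dividedDifference_const {S : Set ℝ} (a : ℝ)
    {n : ℕ} {x : Fin (n + 2) → ℝ} (hx : Monotone x) :
    dividedDifference S (fun _ => a) (n + 1) x = 0 := by
  induction n with
  | zero =>
    rcases hx.fin_lt_or_forall_eq with h | h
    · rw [dividedDifference_of_lt _ _ h]; simp [dividedDifference]
    · rw [dividedDifference_of_eq _ _ h]; simp [iteratedDerivWithin_const]
  | succ n ih =>
    rcases hx.fin_lt_or_forall_eq with h | h
    · rw [dividedDifference_of_lt _ _ h, ih, ih]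
      · simp
      · exact fun i j hij => hx (Fin.castSucc_le_castSucc_iff.2 hij)
      · exact fun i j hij => hx (Fin.succ_le_succ_iff.2 hij)
    · rw [dividedDifference_of_eq _ _ h]; simp [iteratedDerivWithin_const]

theorem dividedDifference_polynomial_sub {S : Set ℝ} (hS : UniqueDiffOn ℝ S) (P Q : ℝ[X])
    {n : ℕ} {x : Fin (n + 1) → ℝ} (hx : Monotone x) (hxS : ∀ i, x i ∈ S) :
    dividedDifference S (fun t => (P - Q).eval t) n x =
      dividedDifference S (fun t => P.eval t) n x - dividedDifference S (fun t => Q.eval t) n x := by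
  simp only [eval_sub]
  exact dividedDifference_sub_of_contDiffOn hS P.contDiff_eval.contDiffOn Q.contDiff_eval.contDiffOn hx hxS

theorem iterate_derivative_X_sub_C_mul_eval (a : ℝ) (Q : ℝ[X]) (n : ℕ) :
    (derivative^[n + 1] ((X - C a) * Q)).eval a / ((n + 1).factorial : ℝ) =
      (derivative^[n] Q).eval a / (n.factorial : ℝ) := by
  have key (P : ℝ[X]) (l : ℕ) : (derivative^[l] P).eval a / (l.factorial : ℝ) =
      (taylor a P).coeff l := by
    have : (l.factorial : ℝ) ≠ 0 := by positivity
    rw [taylor_coeff, ← factorial_smul_hasseDeriv]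
    simp [this]
  rw [key, key]
  simp [taylor_mul]

/-- The Leibniz rule for divided differences with a linear factor vanishing at the first knot. -/
theorem dividedDifference_X_sub_C_mul {S : Set ℝ} (hS : UniqueDiffOn ℝ S) (Q : ℝ[X])
    {n : ℕ} {x : Fin (n + 2) → ℝ} (hx : Monotone x) (hxS : ∀ i, x i ∈ S) :
    dividedDifference S (fun t => ((X - C (x 0)) * Q).eval t) (n + 1) x =
      dividedDifference S (fun t => Q.eval t) n (fun i => x i.succ) := by
  induction n with
  | zero =>
    rcases hx.fin_lt_or_forall_eq with h | h
    · rw [dividedDifference_of_lt _ _ h]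
      have : x (Fin.last 1) - x 0 ≠ 0 := sub_ne_zero.2 h.ne'
      have h1 : x (Fin.last 1) = x 1 := rfl
      rw [h1] at this ⊢
      simp [dividedDifference]
      field_simp
    · rw [dividedDifference_of_eq _ _ h, iteratedDerivWithin_polynomial_eval hS _ _ (hxS 0),
        iterate_derivative_X_sub_C_mul_eval]
      simp [dividedDifference, h 1]
  | succ n ih =>
    rcases hx.fin_lt_or_forall_eq with h | h
    · have hs : Monotone fun i : Fin (n + 2) => x i.succ :=
        fun i j hij => hx (Fin.succ_le_succ_iff.2 hij)
      have hc : Monotone fun i : Fin (n + 2) => x i.castSucc :=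
        fun i j hij => hx (Fin.castSucc_le_castSucc_iff.2 hij)
      have hd : x (Fin.last (n + 2)) - x 0 ≠ 0 := sub_ne_zero.2 h.ne'
      have h2 := ih hc fun i => hxS _
      have h1 := ih hs fun i => hxS _
      have hsplit : ((X - C (x 0)) * Q) =
          ((X - C (x (0 : Fin (n + 2)).succ)) * Q) - C (x 0 - x (0 : Fin (n + 2)).succ) * Q := by
        simp only [map_sub]; ring
      have h3 : dividedDifference S (fun t => (C (x 0 - x (0 : Fin (n + 2)).succ) * Q).eval t)
          (n + 1) (fun i => x i.succ) =
          (x 0 - x (0 : Fin (n + 2)).succ) * dividedDifference S (fun t => Q.eval t)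
            (n + 1) (fun i => x i.succ) := by
        simp only [eval_mul, eval_C]
        exact dividedDifference_const_mul S _ _ hs
      have h4 : dividedDifference S (fun t => Q.eval t) n (fun i => x i.succ.succ) -
          dividedDifference S (fun t => Q.eval t) n (fun i => x i.succ.castSucc) =
          (x (Fin.last (n + 2)) - x (0 : Fin (n + 2)).succ) *
            dividedDifference S (fun t => Q.eval t) (n + 1) (fun i => x i.succ) :=
        dividedDifference_tail_sub_init S _ hs
      rw [dividedDifference_of_lt _ _ h, div_eq_iff hd]
      simp only [Fin.castSucc_zero] at h2
      rw [h2, hsplit, dividedDifference_polynomial_sub hS _ _ hs fun i => hxS _, h1, h3]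
      linear_combination h4
    · rw [dividedDifference_of_eq _ _ h, iteratedDerivWithin_polynomial_eval hS _ _ (hxS 0),
        iterate_derivative_X_sub_C_mul_eval, dividedDifference_of_eq,
        iteratedDerivWithin_polynomial_eval hS _ _ (hxS _), h (Fin.succ 0)]
      intro j
      rw [h, h (Fin.succ 0)]

/-- Divided differences of order `n` of polynomials of degree at most `n`. -/
theorem dividedDifference_polynomial {S : Set ℝ} (hS : UniqueDiffOn ℝ S) (P : ℝ[X])
    {n : ℕ} (hP : P.natDegree ≤ n) {x : Fin (n + 1) → ℝ} (hx : Monotone x) (hxS : ∀ i, x i ∈ S) :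
    dividedDifference S (fun t => P.eval t) n x = P.coeff n := by
  induction n generalizing P with
  | zero =>
    rw [eq_C_of_natDegree_le_zero hP]
    simp [dividedDifference]
  | succ n ih =>
    have hs : Monotone fun i : Fin (n + 1) => x i.succ :=
      fun i j hij => hx (Fin.succ_le_succ_iff.2 hij)
    set Q := P /ₘ (X - C (x 0)) with hQ
    have hPQ : P = (X - C (x 0)) * Q - C (-P.eval (x 0)) := by
      conv_lhs => rw [← modByMonic_add_div P (X - C (x 0)), modByMonic_X_sub_C_eq_C_eval]
      simp only [map_neg]; ring
    have hQd : Q.natDegree ≤ n := by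
      rw [hQ, natDegree_divByMonic _ (monic_X_sub_C _), natDegree_X_sub_C]; omega
    have hc : P.coeff (n + 1) = Q.coeff n := by
      rw [hPQ, coeff_sub, coeff_C_succ, sub_mul, coeff_sub, coeff_X_mul, coeff_C_mul,
        coeff_eq_zero_of_natDegree_lt (Nat.lt_succ_of_le hQd)]
      simp
    rw [hc, ← ih Q hQd hs fun i => hxS _]
    conv_lhs => rw [hPQ]
    rw [dividedDifference_polynomial_sub hS _ _ hx hxS, dividedDifference_X_sub_C_mul hS _ hx hxS]
    simp only [eval_C]
    rw [dividedDifference_const _ hx, sub_zero]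

/-- Divided differences of order `n` are bounded by the `n`-th derivative. -/
theorem abs_dividedDifference_le {S : Set ℝ} (hS : UniqueDiffOn ℝ S) (hSc : S.OrdConnected)
    {n : ℕ} {g : ℝ → ℝ} (hg : ContDiffOn ℝ n g S) {x : Fin (n + 1) → ℝ} (hx : Monotone x)
    (hxS : ∀ i, x i ∈ S) {M : ℝ}
    (hM : ∀ y ∈ Icc (x 0) (x (Fin.last n)), |iteratedDerivWithin n g S y| ≤ M) :
    |dividedDifference S g n x| ≤ 2 ^ n * M := by
  induction n generalizing g M with
  | zero =>
    simpa [dividedDifference] using hM (x 0) ⟨le_rfl, hx (Fin.zero_le _)⟩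
  | succ n ih =>
    have hM0 : 0 ≤ M := (abs_nonneg _).trans (hM (x 0) ⟨le_rfl, hx (Fin.zero_le _)⟩)
    rcases hx.fin_lt_or_forall_eq with h | h
    · have hs : Monotone fun i : Fin (n + 1) => x i.succ :=
        fun i j hij => hx (Fin.succ_le_succ_iff.2 hij)
      have hc : Monotone fun i : Fin (n + 1) => x i.castSucc :=
        fun i j hij => hx (Fin.castSucc_le_castSucc_iff.2 hij)
      have hgn : ContDiffOn ℝ n g S := hg.of_le (by norm_cast; omega)
      have hIS : Icc (x 0) (x (Fin.last (n + 1))) ⊆ S := hSc.out (hxS _) (hxS _)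
      set c := iteratedDerivWithin n g S (x 0) / (n.factorial : ℝ) with hcdef
      set q : ℝ[X] := C c * X ^ n with hq
      have hqn : q.natDegree ≤ n := natDegree_C_mul_X_pow_le _ _
      have hd : 0 < x (Fin.last (n + 1)) - x 0 := sub_pos.2 h
      have key : ∀ y ∈ Icc (x 0) (x (Fin.last (n + 1))),
          |iteratedDerivWithin n (fun t => g t - q.eval t) S y| ≤
            M * (x (Fin.last (n + 1)) - x 0) := by
        intro y hy
        have h1 : iteratedDerivWithin n (fun t => g t - q.eval t) S y =
            iteratedDerivWithin n g S y - iteratedDerivWithin n g S (x 0) := by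
          have := iteratedDerivWithin_sub (hIS hy) hS (hgn _ (hIS hy))
            (q.contDiff_eval.contDiffOn (s := S) _ (hIS hy))
          refine this.trans ?_
          rw [iteratedDerivWithin_polynomial_eval hS _ _ (hIS hy), hq, iterate_derivative_C_mul,
            iterate_derivative_X_pow_eq_C_mul]
          have : (n.factorial : ℝ) ≠ 0 := by positivity
          simp [Nat.descFactorial_self, hcdef, this]
        rw [h1]
        have h2 := (convex_Icc (x 0) (x (Fin.last (n + 1)))).norm_image_sub_le_of_norm_hasDerivWithin_le
          (f := iteratedDerivWithin n g S) (f' := iteratedDerivWithin (n + 1) g S) (C := M)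
          (fun z hz => ?_) hM ⟨le_rfl, h.le⟩ hy
        · refine h2.trans ?_
          rw [Real.norm_eq_abs, abs_of_nonneg (sub_nonneg.2 hy.1)]
          gcongr
          exact hy.2
        · have := (hg.differentiableOn_iteratedDerivWithin (m := n) (by norm_cast; omega) hS _
            (hIS hz)).hasDerivWithinAt
          rw [← iteratedDerivWithin_succ] at this
          exact this.mono hIS
      have hgq : ContDiffOn ℝ n (fun t => g t - q.eval t) S := hgn.sub q.contDiff_eval.contDiffOn
      have b1 := ih hgq hs (fun i => hxS _) fun y hy => key y
        ⟨(hx (Fin.zero_le _)).trans hy.1, hy.2⟩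
      have b2 := ih hgq hc (fun i => hxS _) fun y hy => key y
        ⟨hy.1, hy.2.trans (hx (Fin.le_last _))⟩
      rw [dividedDifference_sub_of_contDiffOn hS hgn q.contDiff_eval.contDiffOn hs fun i => hxS _,
        dividedDifference_polynomial hS q hqn hs fun i => hxS _] at b1
      rw [dividedDifference_sub_of_contDiffOn hS hgn q.contDiff_eval.contDiffOn hc fun i => hxS _,
        dividedDifference_polynomial hS q hqn hc fun i => hxS _] at b2
      rw [dividedDifference_of_lt _ _ h, abs_div, abs_of_pos hd, div_le_iff₀ hd]
      rw [abs_le] at b1 b2 ⊢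
      constructor <;> rw [pow_succ] <;> linarith [b1.1, b1.2, b2.1, b2.2]
    · rw [dividedDifference_of_eq _ _ h, abs_div]
      have h1 := hM (x 0) ⟨le_rfl, hx (Fin.zero_le _)⟩
      have h2 : (1 : ℝ) ≤ |((n + 1).factorial : ℝ)| := by
        rw [abs_of_nonneg (by positivity)]
        exact_mod_cast Nat.one_le_iff_ne_zero.2 (Nat.factorial_ne_zero _)
      calc _ ≤ |iteratedDerivWithin (n + 1) g S (x 0)| := div_le_self (abs_nonneg _) h2
        _ ≤ M := h1
        _ ≤ 2 ^ (n + 1) * M := le_mul_of_one_le_left hM0 (one_le_pow₀ (by norm_num))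

/-- The Steklov average of `g` with step `h`. -/
noncomputable def steklovMean (h : ℝ) (g : ℝ → ℝ) (x : ℝ) : ℝ := ∫ t in (0 : ℝ)..1, g (x + h * t)

theorem steklovMean_zero (g : ℝ → ℝ) : steklovMean 0 g = g := by
  ext x; simp [steklovMean]

theorem Continuous.steklovMean {g : ℝ → ℝ} (hg : Continuous g) (h : ℝ) :
    Continuous (steklovMean h g) := by
  unfold _root_.steklovMean
  exact intervalIntegral.continuous_parametric_intervalIntegral_of_continuous' (by fun_prop) _ _

theorem Continuous.iterate_steklovMean {g : ℝ → ℝ} (hg : Continuous g) (h : ℝ) (n : ℕ) :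
    Continuous ((_root_.steklovMean h)^[n] g) := by
  induction n with
  | zero => exact hg
  | succ n ih => rw [Function.iterate_succ_apply']; exact ih.steklovMean h

theorem Continuous.fwdDiff {g : ℝ → ℝ} (hg : Continuous g) (h : ℝ) : Continuous (fwdDiff h g) := by
  unfold _root_.fwdDiff; fun_prop

theorem steklovMean_fwdDiff {g : ℝ → ℝ} (hg : Continuous g) (h : ℝ) :
    steklovMean h (fwdDiff h g) = fwdDiff h (steklovMean h g) := by
  ext x
  simp only [steklovMean, fwdDiff]
  rw [intervalIntegral.integral_sub]
  · congr 2; ext t; ring_nf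
  · exact Continuous.intervalIntegrable (by fun_prop) _ _
  · exact Continuous.intervalIntegrable (by fun_prop) _ _

theorem iterate_steklovMean_fwdDiff {g : ℝ → ℝ} (hg : Continuous g) (h : ℝ) (n : ℕ) :
    (steklovMean h)^[n] (fwdDiff h g) = fwdDiff h ((steklovMean h)^[n] g) := by
  induction n with
  | zero => rfl
  | succ n ih =>
    rw [Function.iterate_succ_apply', Function.iterate_succ_apply', ih,
      steklovMean_fwdDiff (hg.iterate_steklovMean h n)]

theorem hasDerivAt_steklovMean {g : ℝ → ℝ} (hg : Continuous g) {h : ℝ} (hh : h ≠ 0) (x : ℝ) :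
    HasDerivAt (steklovMean h g) (h⁻¹ * fwdDiff h g x) x := by
  have e : steklovMean h g = fun x => h⁻¹ * ((∫ t in (0 : ℝ)..(x + h), g t) - ∫ t in (0 : ℝ)..x, g t) := by
    ext y
    rw [steklovMean, intervalIntegral.integral_comp_add_mul _ hh,
      intervalIntegral.integral_interval_sub_left (hg.intervalIntegrable _ _)
        (hg.intervalIntegrable _ _)]
    simp
  rw [e]
  have h1 (y : ℝ) : HasDerivAt (fun y => ∫ t in (0 : ℝ)..y, g t) (g y) y :=
    intervalIntegral.integral_hasDerivAt_right (hg.intervalIntegrable _ _)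
      (hg.stronglyMeasurableAtFilter _ _) hg.continuousAt
  have h2 : HasDerivAt (fun y => ∫ t in (0 : ℝ)..(y + h), g t) (g (x + h)) x :=
    (h1 (x + h)).comp_add_const x h
  exact (h2.sub (h1 x)).const_mul _

theorem contDiff_iterate_steklovMean {g : ℝ → ℝ} (hg : Continuous g) {h : ℝ} (hh : h ≠ 0) (n : ℕ) :
    ContDiff ℝ n ((steklovMean h)^[n] g) ∧
      iteratedDeriv n ((steklovMean h)^[n] g) = fun x => h⁻¹ ^ n * (fwdDiff h)^[n] g x := by
  induction n generalizing g with
  | zero => simp [contDiff_zero, hg]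
  | succ n ih =>
    have hd (x : ℝ) : HasDerivAt ((steklovMean h)^[n + 1] g)
        (h⁻¹ * (steklovMean h)^[n] (fwdDiff h g) x) x := by
      rw [iterate_steklovMean_fwdDiff hg, Function.iterate_succ_apply']
      exact hasDerivAt_steklovMean (hg.iterate_steklovMean h n) hh x
    have hderiv : deriv ((steklovMean h)^[n + 1] g) =
        fun x => h⁻¹ * (steklovMean h)^[n] (fwdDiff h g) x := funext fun x => (hd x).deriv
    obtain ⟨h1, h2⟩ := ih (hg.fwdDiff h)
    constructor
    · have : ((n + 1 : ℕ) : WithTop ℕ∞) = (n : WithTop ℕ∞) + 1 := by norm_cast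
      rw [this, contDiff_succ_iff_deriv]
      refine ⟨fun x => (hd x).differentiableAt, by simp, ?_⟩
      rw [hderiv]
      exact contDiff_const.mul h1
    · rw [iteratedDeriv_succ', hderiv]
      ext x
      rw [iteratedDeriv_const_mul_field, h2, Function.iterate_succ_apply]
      ring

theorem abs_sum_iterate_steklovMean_le {ι : Type*} (s : Finset ι) (c d : ι → ℝ) {g : ℝ → ℝ}
    (hg : Continuous g) {x w : ℝ} {n : ℕ} {τ : ℝ}
    (hw : ∀ v ∈ Icc τ (τ + n), |∑ i ∈ s, c i * g (x + d i * v)| ≤ w) :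
    |∑ i ∈ s, c i * (steklovMean (d i))^[n] g (x + d i * τ)| ≤ w := by
  induction n generalizing τ with
  | zero => simpa using hw τ (by simp)
  | succ n ih =>
    have e : ∑ i ∈ s, c i * (steklovMean (d i))^[n + 1] g (x + d i * τ) =
        ∫ t in (0 : ℝ)..1, ∑ i ∈ s, c i * (steklovMean (d i))^[n] g (x + d i * (τ + t)) := by
      rw [intervalIntegral.integral_finsetSum]
      · refine Finset.sum_congr rfl fun i _ => ?_
        rw [Function.iterate_succ_apply', intervalIntegral.integral_const_mul, steklovMean]
        congr 2; ext t; ring_nf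
      · intro i _
        have := hg.iterate_steklovMean (d i) n
        exact Continuous.intervalIntegrable (by fun_prop) _ _
    rw [e]
    have := intervalIntegral.norm_integral_le_of_norm_le_const (a := (0 : ℝ)) (b := 1) (C := w)
      (f := fun t => ∑ i ∈ s, c i * (steklovMean (d i))^[n] g (x + d i * (τ + t))) ?_
    · simpa using this
    · intro t ht
      rw [uIoc_of_le zero_le_one] at ht
      refine ih fun v hv => hw v ⟨by linarith [hv.1, ht.1], ?_⟩
      push_cast
      linarith [hv.2, ht.2]

theorem fwdDiff_iter_eq_sum (g : ℝ → ℝ) (k : ℕ) (u x : ℝ) :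
    (fwdDiff u)^[k] g x =
      ∑ i ∈ Finset.range (k + 1), ((-1) ^ (k - i) * (k.choose i : ℝ)) * g (x + i * u) := by
  rw [fwdDiff_iter_eq_sum_shift]
  refine Finset.sum_congr rfl fun i _ => ?_
  simp

theorem sum_choose_real (k : ℕ) : ∑ i ∈ Finset.range (k + 1), (k.choose i : ℝ) = 2 ^ k := by
  exact_mod_cast Nat.sum_range_choose k

/-- Polynomial approximation on the left half of `[0,1]` in terms of `k`-th differences. -/
theorem exists_polynomial_approx_left_half {k : ℕ} (hk : 1 ≤ k) {g : ℝ → ℝ} (hg : Continuous g)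
    {w : ℝ} (hw0 : 0 ≤ w)
    (hw : ∀ x u : ℝ, 0 < u → 0 ≤ x → x + k * u ≤ 1 → |(fwdDiff u)^[k] g x| ≤ w) :
    ∃ P : ℝ[X], P.natDegree < k ∧
      ∀ x ∈ Icc (0 : ℝ) (1 / 2), |g x - P.eval x| ≤ (1 + 2 ^ k * (2 * k ^ 2) ^ k) * w := by
  obtain ⟨n, rfl⟩ : ∃ n, k = n + 1 := ⟨k - 1, by omega⟩
  set k := n + 1 with hkdef
  have hk0 : (0 : ℝ) < k := by positivity
  have hk1 : (1 : ℝ) ≤ k := by exact_mod_cast hk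
  set h : ℝ := (2 * (k : ℝ) ^ 2)⁻¹ with hh
  have hh0 : 0 < h := by positivity
  have hkh : (k : ℝ) * k * h = 1 / 2 := by rw [hh]; field_simp
  set c : ℕ → ℝ := fun i => (-1) ^ (k - i) * (k.choose i : ℝ) with hc
  have hcabs (i : ℕ) : |c i| = (k.choose i : ℝ) := by simp [hc, abs_mul]
  set Sm : ℕ → ℝ → ℝ := fun i => (steklovMean ((i : ℝ) * h))^[k] g with hSm
  have hSm0 : Sm 0 = g := by
    simp only [hSm, Nat.cast_zero, zero_mul]
    exact Function.iterate_fixed (steklovMean_zero g) k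
  set G : ℝ → ℝ := fun x => -(c 0 * ∑ i ∈ Finset.range k, c (i + 1) * Sm (i + 1) x) with hG
  have hc0 : c 0 * c 0 = 1 := by
    simp only [hc, Nat.sub_zero, Nat.choose_zero_right, Nat.cast_one, mul_one]
    rw [← pow_add, ← two_mul]; simp
  have hc0abs : |c 0| = 1 := by simp [hcabs]
  have hclose : ∀ x ∈ Icc (0 : ℝ) (1 / 2), |g x - G x| ≤ w := by
    intro x hx
    have h1 := abs_sum_iterate_steklovMean_le (Finset.range (k + 1)) c (fun i => (i : ℝ) * h) hg
      (x := x) (w := w) (n := k) (τ := 0) ?_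
    · have h2 : g x - G x = c 0 * ∑ i ∈ Finset.range (k + 1), c i * Sm i x := by
        rw [Finset.sum_range_succ', hSm0, mul_add, ← mul_assoc, hc0]
        simp only [hG]
        ring
      rw [h2, abs_mul, hc0abs, one_mul]
      simpa using h1
    · intro v hv
      have e : ∑ i ∈ Finset.range (k + 1), c i * g (x + (i : ℝ) * h * v) =
          (fwdDiff (h * v))^[k] g x := by
        rw [fwdDiff_iter_eq_sum]
        refine Finset.sum_congr rfl fun i _ => ?_
        congr 2; ring
      rw [e]
      rcases hv.1.eq_or_lt with h0 | h0
      · rw [← h0, mul_zero, hkdef, Function.iterate_succ_apply']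
        simpa [fwdDiff] using hw0
      · refine hw _ _ (by positivity) hx.1 ?_
        have h3 : v ≤ k := by simpa using hv.2
        have : (k : ℝ) * (h * v) ≤ k * (h * k) := by gcongr
        linarith [hx.2]
  have hne (i : ℕ) : ((i + 1 : ℕ) : ℝ) * h ≠ 0 := by positivity
  have hSmC (i : ℕ) := contDiff_iterate_steklovMean hg (hne i) k
  have hGC : ContDiff ℝ k G := by
    refine (contDiff_const.mul (ContDiff.sum fun i _ => contDiff_const.mul ?_)).neg
    exact (hSmC i).1
  have hGd : ∀ x ∈ Icc (0 : ℝ) (1 / 2), |iteratedDeriv k G x| ≤ 2 ^ k * (2 * (k : ℝ) ^ 2) ^ k * w := by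
    intro x hx
    have e : iteratedDeriv k G x = -(c 0 * ∑ i ∈ Finset.range k, c (i + 1) *
        (((((i + 1 : ℕ) : ℝ) * h)⁻¹) ^ k * (fwdDiff (((i + 1 : ℕ) : ℝ) * h))^[k] g x)) := by
      rw [hG, iteratedDeriv_fun_neg, iteratedDeriv_const_mul_field, iteratedDeriv_fun_sum]
      · congr 2
        refine Finset.sum_congr rfl fun i _ => ?_
        rw [iteratedDeriv_const_mul_field]
        simp only [hSm]
        rw [(hSmC i).2]
      · intro i _
        exact (contDiff_const.mul (hSmC i).1).contDiffAt
    rw [e, abs_neg, abs_mul, hc0abs, one_mul]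
    calc _ ≤ ∑ i ∈ Finset.range k, |c (i + 1) *
        (((((i + 1 : ℕ) : ℝ) * h)⁻¹) ^ k * (fwdDiff (((i + 1 : ℕ) : ℝ) * h))^[k] g x)| :=
          Finset.abs_sum_le_sum_abs _ _
      _ ≤ ∑ i ∈ Finset.range k, (k.choose (i + 1) : ℝ) * ((2 * (k : ℝ) ^ 2) ^ k * w) := by
          refine Finset.sum_le_sum fun i hi => ?_
          rw [abs_mul, hcabs, abs_mul, abs_of_nonneg (by positivity : 0 ≤ ((((i + 1 : ℕ) : ℝ) * h)⁻¹) ^ k)]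
          have hi1 : (1 : ℝ) ≤ ((i + 1 : ℕ) : ℝ) := by exact_mod_cast Nat.succ_pos i
          have hik : ((i + 1 : ℕ) : ℝ) ≤ k := by exact_mod_cast Finset.mem_range.1 hi
          have hpos : 0 < ((i + 1 : ℕ) : ℝ) * h := by positivity
          gcongr
          · rw [mul_inv, hh, inv_inv]
            exact mul_le_of_le_one_left (by positivity) (inv_le_one_of_one_le₀ hi1)
          · refine hw _ _ hpos hx.1 ?_
            have : (k : ℝ) * (((i + 1 : ℕ) : ℝ) * h) ≤ k * (k * h) := by gcongr
            linarith [hx.2]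
      _ = (∑ i ∈ Finset.range k, (k.choose (i + 1) : ℝ)) * ((2 * (k : ℝ) ^ 2) ^ k * w) := by
          rw [Finset.sum_mul]
      _ ≤ 2 ^ k * ((2 * (k : ℝ) ^ 2) ^ k * w) := by
          gcongr
          rw [← sum_choose_real k, Finset.sum_range_succ' _ k]
          simp
      _ = _ := by ring
  set I : Set ℝ := Icc (0 : ℝ) (1 / 2) with hI
  have hIu : UniqueDiffOn ℝ I := uniqueDiffOn_Icc (by norm_num)
  refine ⟨∑ i ∈ Finset.range k, C ((i.factorial : ℝ)⁻¹ * iteratedDerivWithin i G I 0) * X ^ i, ?_, ?_⟩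
  · refine Order.lt_succ_of_le (b := n) (natDegree_sum_le_of_forall_le _ _ fun i hi => (natDegree_C_mul_X_pow_le _ _).trans ?_)
    exact Nat.lt_succ_iff.1 (Finset.mem_range.1 hi)
  · intro x hx
    have ht := taylor_mean_remainder_bound (f := G) (a := 0) (b := 1 / 2) (n := n)
      (C := 2 ^ k * (2 * (k : ℝ) ^ 2) ^ k * w) (x := x) (by norm_num)
      (by
        have : ((n : WithTop ℕ∞) + 1) = (k : ℕ) := by rw [hkdef]; norm_cast
        rw [this]
        exact hGC.contDiffOn) hx (by
        intro y hy
        rw [iteratedDerivWithin_eq_iteratedDeriv hIu hGC.contDiffAt hy]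
        exact hGd y hy)
    rw [taylor_within_apply] at ht
    have e : (∑ i ∈ Finset.range k, C ((i.factorial : ℝ)⁻¹ * iteratedDerivWithin i G I 0) * X ^ i).eval x
        = ∑ j ∈ Finset.range (n + 1), ((j.factorial : ℝ)⁻¹ * (x - 0) ^ j) •
          iteratedDerivWithin j G I 0 := by
      rw [eval_finsetSum]
      refine Finset.sum_congr rfl fun i _ => ?_
      simp only [eval_mul, eval_C, eval_pow, eval_X, sub_zero, smul_eq_mul]
      ring
    rw [← e, Real.norm_eq_abs] at ht
    have hB : (0:ℝ) ≤ 2 ^ k * (2 * (k : ℝ) ^ 2) ^ k * w := by positivity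
    have ht' : 2 ^ k * (2 * (k : ℝ) ^ 2) ^ k * w * (x - 0) ^ (n + 1) / (n.factorial : ℝ) ≤
        2 ^ k * (2 * (k : ℝ) ^ 2) ^ k * w := by
      rw [sub_zero]
      have h1 : x ^ (n + 1) ≤ 1 := pow_le_one₀ hx.1 (by linarith [hx.2])
      have h2 : (1 : ℝ) ≤ (n.factorial : ℝ) := by
        exact_mod_cast Nat.one_le_iff_ne_zero.2 (Nat.factorial_ne_zero _)
      have h3 : 0 ≤ x ^ (n + 1) := pow_nonneg hx.1 _
      refine (div_le_self (mul_nonneg hB h3) h2).trans (mul_le_of_le_one_right hB h1)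
    calc _ ≤ |g x - G x| + |G x - _| := abs_sub_le _ _ _
      _ ≤ w + 2 ^ k * (2 * (k : ℝ) ^ 2) ^ k * w := add_le_add (hclose x hx) (ht.trans ht')
      _ = _ := by ring

theorem fwdDiff_iter_polynomial_eq_zero {P : ℝ[X]} {k : ℕ} (hP : P.natDegree < k) (u x : ℝ) :
    (fwdDiff u)^[k] (fun t => P.eval t) x = 0 := by
  set Q := P.comp (C u * X + C x) with hQ
  have hQd : Q.natDegree < k := by
    refine lt_of_le_of_lt natDegree_comp_le (lt_of_le_of_lt ?_ hP)
    exact (Nat.mul_le_mul_left _ natDegree_linear_le).trans (mul_one _).le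
  have h := congrFun (fwdDiff_iter_eq_zero_of_degree_lt hQd) 0
  rw [fwdDiff_iter_eq_sum] at h ⊢
  simp only [Pi.zero_apply] at h
  rw [← h]
  refine Finset.sum_congr rfl fun i _ => ?_
  simp only [hQ, eval_comp, eval_add, eval_mul, eval_C, eval_X]
  congr 2; ring

/-- Whitney's inequality on `[0,1]`. -/
theorem exists_polynomial_approx_unit {k : ℕ} (hk : 1 ≤ k) :
    ∃ K : ℝ, 0 < K ∧ ∀ (g : ℝ → ℝ) (_ : Continuous g) (w : ℝ), 0 ≤ w →
      (∀ x u : ℝ, 0 < u → 0 ≤ x → x + k * u ≤ 1 → |(fwdDiff u)^[k] g x| ≤ w) →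
      ∃ P : ℝ[X], P.natDegree < k ∧ ∀ x ∈ Icc (0 : ℝ) 1, |g x - P.eval x| ≤ K * w := by
  have hk1 : (1 : ℝ) ≤ k := by exact_mod_cast hk
  have hk0 : (0 : ℝ) < k := by linarith
  set ρ : ℝ := (k - 1) / k with hρ
  have hρ0 : 0 ≤ ρ := div_nonneg (by linarith) hk0.le
  have hρ1 : ρ < 1 := by rw [hρ, div_lt_one hk0]; linarith
  obtain ⟨N, hN⟩ := exists_pow_lt_of_lt_one (by norm_num : (0 : ℝ) < 1 / 2) hρ1
  set B : ℝ := 1 + 2 ^ k * (2 * k ^ 2) ^ k with hB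
  have hB1 : 1 ≤ B := by rw [hB]; exact le_add_of_nonneg_right (by positivity)
  refine ⟨(1 + 2 ^ k) ^ N * B, by positivity, fun g hg w hw0 hw => ?_⟩
  obtain ⟨P, hPd, hP⟩ := exists_polynomial_approx_left_half hk hg hw0 hw
  refine ⟨P, hPd, ?_⟩
  have key (M : ℕ) : ∀ x ∈ Icc (0 : ℝ) 1, ρ ^ M * x ≤ 1 / 2 →
      |g x - P.eval x| ≤ (1 + 2 ^ k) ^ M * B * w := by
    induction M with
    | zero =>
      intro x hx hx2
      simpa using hP x ⟨hx.1, by simpa using hx2⟩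
    | succ M ih =>
      intro x hx hx2
      rcases hx.1.eq_or_lt with h0 | h0
      · refine (hP x ⟨hx.1, by rw [← h0]; norm_num⟩).trans ?_
        rw [mul_assoc]
        exact le_mul_of_one_le_left (by positivity)
          (one_le_pow₀ (le_add_of_nonneg_right (by positivity)))
      have hxk : 0 < x / k := by positivity
      have hkx : (k : ℝ) * (x / k) = x := by field_simp
      have hd : (fwdDiff (x / k))^[k] (fun t => g t - P.eval t) 0 = (fwdDiff (x / k))^[k] g 0 := by
        have hz := fwdDiff_iter_polynomial_eq_zero hPd (x / k) 0
        rw [fwdDiff_iter_eq_sum] at hz ⊢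
        rw [fwdDiff_iter_eq_sum]
        simp only [mul_sub, Finset.sum_sub_distrib, hz, sub_zero]
      have hD := hw 0 (x / k) hxk le_rfl (by rw [hkx]; linarith [hx.2])
      rw [← hd, fwdDiff_iter_eq_sum, Finset.sum_range_succ] at hD
      simp only [Nat.sub_self, pow_zero, Nat.choose_self, Nat.cast_one, one_mul, zero_add, hkx] at hD
      have hS : |∑ i ∈ Finset.range k, (-1) ^ (k - i) * (k.choose i : ℝ) *
          (g (i * (x / k)) - P.eval (i * (x / k)))| ≤ 2 ^ k * ((1 + 2 ^ k) ^ M * B * w) := by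
        calc _ ≤ ∑ i ∈ Finset.range k, |(-1) ^ (k - i) * (k.choose i : ℝ) *
          (g (i * (x / k)) - P.eval (i * (x / k)))| := Finset.abs_sum_le_sum_abs _ _
          _ ≤ ∑ i ∈ Finset.range k, (k.choose i : ℝ) * ((1 + 2 ^ k) ^ M * B * w) := by
            refine Finset.sum_le_sum fun i hi => ?_
            have hik : (i : ℝ) ≤ k - 1 := by
              have : i + 1 ≤ k := Finset.mem_range.1 hi
              have : ((i + 1 : ℕ) : ℝ) ≤ k := by exact_mod_cast this
              push_cast at this; linarith
            have hix : (i : ℝ) * (x / k) ≤ ρ * x := by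
              have : (i : ℝ) * (x / k) ≤ (k - 1) * (x / k) := by gcongr
              refine this.trans (le_of_eq ?_)
              rw [hρ]; ring
            rw [abs_mul, abs_mul, abs_pow, abs_neg, abs_one, one_pow, one_mul, Nat.abs_cast]
            gcongr
            refine ih _ ⟨by positivity, hix.trans ?_⟩ ?_
            · exact mul_le_one₀ hρ1.le hx.1 hx.2
            · calc ρ ^ M * (i * (x / k)) ≤ ρ ^ M * (ρ * x) := by gcongr
                _ = ρ ^ (M + 1) * x := by ring
                _ ≤ 1 / 2 := hx2
          _ = (∑ i ∈ Finset.range k, (k.choose i : ℝ)) * ((1 + 2 ^ k) ^ M * B * w) := by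
            rw [Finset.sum_mul]
          _ ≤ _ := by
            gcongr
            rw [← sum_choose_real k, Finset.sum_range_succ]
            simp
      have hwB : w ≤ (1 + 2 ^ k) ^ M * B * w :=
        le_mul_of_one_le_left hw0 (one_le_mul_of_one_le_of_one_le
          (one_le_pow₀ (le_add_of_nonneg_right (by positivity))) hB1)
      have htri : |g x - P.eval x| ≤ w + 2 ^ k * ((1 + 2 ^ k) ^ M * B * w) := by
        rw [abs_le] at hD hS ⊢
        constructor <;> linarith [hD.1, hD.2, hS.1, hS.2]
      calc _ ≤ w + 2 ^ k * ((1 + 2 ^ k) ^ M * B * w) := htri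
        _ ≤ (1 + 2 ^ k) ^ M * B * w + 2 ^ k * ((1 + 2 ^ k) ^ M * B * w) := by gcongr
        _ = _ := by ring
  intro x hx
  refine key N x hx ?_
  exact (mul_le_of_le_one_right (by positivity) hx.2).trans hN.le

/-- Whitney's inequality: a continuous function with small `k`-th differences on `[a,b]` is
uniformly close to a polynomial of degree less than `k`. -/
theorem exists_polynomial_approx {k : ℕ} (hk : 1 ≤ k) :
    ∃ K : ℝ, 0 < K ∧ ∀ (a b : ℝ) (_ : a < b) (g : ℝ → ℝ) (_ : ContinuousOn g (Icc a b)) (w : ℝ),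
      0 ≤ w → (∀ x u : ℝ, 0 < u → a ≤ x → x + k * u ≤ b → |(fwdDiff u)^[k] g x| ≤ w) →
      ∃ P : ℝ[X], P.natDegree < k ∧ ∀ x ∈ Icc a b, |g x - P.eval x| ≤ K * w := by
  obtain ⟨K, hK, H⟩ := exists_polynomial_approx_unit hk
  refine ⟨K, hK, fun a b hab g hg w hw0 hw => ?_⟩
  have hba : 0 < b - a := sub_pos.2 hab
  set g' : ℝ → ℝ := IccExtend hab.le ((Icc a b).domRestrict g) with hg'
  have hg'c : Continuous g' := (continuousOn_iff_continuous_domRestrict.1 hg).Icc_extend'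
  have hg'e {x : ℝ} (hx : x ∈ Icc a b) : g' x = g x := by
    rw [hg', IccExtend_of_mem hab.le _ hx]; rfl
  obtain ⟨P, hPd, hP⟩ := H (fun t => g' (a + (b - a) * t)) (by fun_prop) w hw0 (by
    intro x u hu hx hxu
    have e : (fwdDiff u)^[k] (fun t => g' (a + (b - a) * t)) x =
        (fwdDiff ((b - a) * u))^[k] g (a + (b - a) * x) := by
      rw [fwdDiff_iter_eq_sum, fwdDiff_iter_eq_sum]
      refine Finset.sum_congr rfl fun i hi => ?_
      have hik : (i : ℝ) ≤ k := by
        exact_mod_cast Nat.lt_succ_iff.1 (Finset.mem_range.1 hi)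
      have h1 : x + i * u ≤ 1 := le_trans (by gcongr) hxu
      have h2 : 0 ≤ x + i * u := by positivity
      rw [hg'e ⟨?_, ?_⟩]
      · congr 2; ring
      · have : 0 ≤ (b - a) * (x + i * u) := by positivity
        linarith
      · have : (b - a) * (x + i * u) ≤ b - a := mul_le_of_le_one_right hba.le h1
        linarith
    rw [e]
    refine hw _ _ (by positivity) ?_ ?_
    · have : 0 ≤ (b - a) * x := by positivity
      linarith
    · have : (b - a) * (x + k * u) ≤ b - a := mul_le_of_le_one_right hba.le hxu
      linarith)
  refine ⟨P.comp (C (b - a)⁻¹ * X + C (-(b - a)⁻¹ * a)), ?_, ?_⟩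
  · refine lt_of_le_of_lt natDegree_comp_le (lt_of_le_of_lt ?_ hPd)
    exact (Nat.mul_le_mul_left _ natDegree_linear_le).trans (mul_one _).le
  · intro x hx
    have e : (b - a)⁻¹ * x + -(b - a)⁻¹ * a = (x - a) / (b - a) := by field_simp; ring
    have h1 := hP ((x - a) / (b - a)) ⟨div_nonneg (by linarith [hx.1]) hba.le,
      (div_le_one hba).2 (by linarith [hx.2])⟩
    rw [mul_div_cancel₀ _ hba.ne', add_sub_cancel, hg'e hx] at h1
    simpa only [eval_comp, eval_add, eval_mul, eval_C, eval_X, e] using h1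

theorem iterate_derivative_comp_linear (P : ℝ[X]) (c d : ℝ) (l : ℕ) :
    derivative^[l] (P.comp (C c * X + C d)) =
      C (c ^ l) * (derivative^[l] P).comp (C c * X + C d) := by
  induction l with
  | zero => simp
  | succ l ih =>
    rw [Function.iterate_succ_apply', ih, Function.iterate_succ_apply', derivative_C_mul,
      derivative_comp]
    simp only [derivative_add, derivative_mul, derivative_C, derivative_X, zero_mul, zero_add,
      mul_one, add_zero, pow_succ, C_mul]
    ring

/-- A Markov type inequality on `[0,1]`. -/
theorem exists_iterate_derivative_bound_unit (k l : ℕ) :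
    ∃ K : ℝ, 0 < K ∧ ∀ P : ℝ[X], P.natDegree < k → ∀ w : ℝ,
      (∀ x ∈ Icc (0 : ℝ) 1, |P.eval x| ≤ w) →
      ∀ x ∈ Icc (0 : ℝ) 1, |(derivative^[l] P).eval x| ≤ K * w := by
  set v : ℕ → ℝ := fun i => (i : ℝ) / k with hv
  set s := Finset.range k with hs
  have hB (i : ℕ) : ∃ M, ∀ x ∈ Icc (0 : ℝ) 1, ‖(derivative^[l] (Lagrange.basis s v i)).eval x‖ ≤ M :=
    isCompact_Icc.exists_bound_of_continuousOn (Polynomial.continuous _).continuousOn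
  choose M hM using hB
  have hM0 (i : ℕ) : 0 ≤ M i := (norm_nonneg _).trans (hM i 0 ⟨le_rfl, zero_le_one⟩)
  refine ⟨1 + ∑ i ∈ s, M i, by have := Finset.sum_nonneg fun i (_ : i ∈ s) => hM0 i; linarith,
    fun P hP w hw x hx => ?_⟩
  have hw0 : 0 ≤ w := (abs_nonneg _).trans (hw 0 ⟨le_rfl, zero_le_one⟩)
  have hk : (0 : ℝ) < k := by exact_mod_cast (Nat.zero_le _).trans_lt hP
  have hinj : Set.InjOn v s := by
    intro i _ j _ hij
    simp only [hv] at hij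
    have := (div_left_inj' hk.ne').1 hij
    exact_mod_cast this
  have hdeg : P.degree < s.card := by
    rw [hs, Finset.card_range]
    exact lt_of_le_of_lt degree_le_natDegree (by exact_mod_cast hP)
  have hPe : P = ∑ i ∈ s, C (P.eval (v i)) * Lagrange.basis s v i := by
    conv_lhs => rw [Lagrange.eq_interpolate hinj hdeg, Lagrange.interpolate_apply]
  have e : (derivative^[l] P).eval x =
      ∑ i ∈ s, P.eval (v i) * (derivative^[l] (Lagrange.basis s v i)).eval x := by
    conv_lhs => rw [hPe]
    rw [iterate_derivative_sum, eval_finsetSum]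
    refine Finset.sum_congr rfl fun i _ => ?_
    rw [iterate_derivative_C_mul, eval_mul, eval_C]
  rw [e]
  calc _ ≤ ∑ i ∈ s, |P.eval (v i) * (derivative^[l] (Lagrange.basis s v i)).eval x| :=
        Finset.abs_sum_le_sum_abs _ _
    _ ≤ ∑ i ∈ s, w * M i := by
        refine Finset.sum_le_sum fun i hi => ?_
        rw [abs_mul]
        gcongr
        · refine hw _ ⟨by positivity, ?_⟩
          rw [hv, div_le_one hk]
          exact_mod_cast (Finset.mem_range.1 hi).le
        · exact hM i x hx
    _ = (∑ i ∈ s, M i) * w := by rw [← Finset.mul_sum, mul_comm]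
    _ ≤ _ := by gcongr; linarith

/-- A Markov type inequality for polynomials on `[a,b]`. -/
theorem exists_iterate_derivative_bound (k l : ℕ) :
    ∃ K : ℝ, 0 < K ∧ ∀ P : ℝ[X], P.natDegree < k → ∀ w a b : ℝ, a < b →
      (∀ x ∈ Icc a b, |P.eval x| ≤ w) →
      ∀ x ∈ Icc a b, |(derivative^[l] P).eval x| ≤ K * w / (b - a) ^ l := by
  obtain ⟨K, hK, H⟩ := exists_iterate_derivative_bound_unit k l
  refine ⟨K, hK, fun P hP w a b hab hw x hx => ?_⟩
  have hba : 0 < b - a := sub_pos.2 hab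
  have hx1 : (x - a) / (b - a) ∈ Icc (0 : ℝ) 1 :=
    ⟨div_nonneg (by linarith [hx.1]) hba.le, (div_le_one hba).2 (by linarith [hx.2])⟩
  have h := H (P.comp (C (b - a) * X + C a))
    (lt_of_le_of_lt (natDegree_comp_le.trans
      ((Nat.mul_le_mul_left _ natDegree_linear_le).trans (mul_one _).le)) hP) w (by
      intro y hy
      simp only [eval_comp, eval_add, eval_mul, eval_C, eval_X]
      have h1 : 0 ≤ (b - a) * y := mul_nonneg hba.le hy.1
      have h2 : (b - a) * y ≤ b - a := mul_le_of_le_one_right hba.le hy.2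
      exact hw _ ⟨by linarith, by linarith⟩) _ hx1
  rw [iterate_derivative_comp_linear] at h
  simp only [eval_comp, eval_add, eval_mul, eval_C, eval_X] at h
  rw [mul_div_cancel₀ _ hba.ne', sub_add_cancel, abs_mul, abs_of_pos (pow_pos hba l)] at h
  rw [le_div_iff₀ (pow_pos hba l)]
  linarith

theorem Monotone.intervalIntegrable_mul {φ w : ℝ → ℝ} (hφ : Monotone φ)
    (hw : ContinuousOn w (Ioi 0)) {a b : ℝ} (ha : 0 < a) (hab : a ≤ b) :
    IntervalIntegrable (fun u => φ u * w u) MeasureTheory.volume a b := by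
  refine hφ.intervalIntegrable.mul_continuousOn (hw.mono ?_)
  rw [uIcc_of_le hab]
  exact fun u hu => ha.trans_le hu.1

/-- Enlarging the interval of integration of a nonnegative integrand. -/
theorem Monotone.integral_mul_mono_interval {φ w : ℝ → ℝ} (hφ : Monotone φ) (hφ0 : ∀ u, 0 ≤ φ u)
    (hw : ContinuousOn w (Ioi 0)) (hw0 : ∀ u, 0 < u → 0 ≤ w u) {a b a' b' : ℝ} (ha : 0 < a)
    (haa : a ≤ a') (hab : a' ≤ b') (hbb : b' ≤ b) :
    ∫ u in a'..b', φ u * w u ≤ ∫ u in a..b, φ u * w u := by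
  refine intervalIntegral.integral_mono_interval haa hab hbb ?_
    (hφ.intervalIntegrable_mul hw ha (haa.trans (hab.trans hbb)))
  refine (MeasureTheory.ae_restrict_iff' measurableSet_Ioc).2 (Filter.Eventually.of_forall ?_)
  exact fun u hu => mul_nonneg (hφ0 u) (hw0 u (ha.trans hu.1))

theorem integral_mul_nonneg_of_pos {φ w : ℝ → ℝ} (hφ0 : ∀ u, 0 ≤ φ u)
    (hw0 : ∀ u, 0 < u → 0 ≤ w u) {a b : ℝ} (ha : 0 < a) (hab : a ≤ b) :
    0 ≤ ∫ u in a..b, φ u * w u :=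
  intervalIntegral.integral_nonneg hab fun u hu =>
    mul_nonneg (hφ0 u) (hw0 u (ha.trans_le hu.1))

theorem continuousOn_inv_pow (n : ℕ) : ContinuousOn (fun u : ℝ => (u ^ n)⁻¹) (Ioi 0) :=
  (continuous_pow n).continuousOn.inv₀ fun _ hu => (pow_pos hu n).ne'

theorem Monotone.le_integral_inv_pow {φ : ℝ → ℝ} (hφ : Monotone φ) (hφ0 : ∀ u, 0 ≤ φ u) (l : ℕ)
    {L : ℝ} (hL : 0 < L) :
    φ L / L ^ l ≤ 2 ^ (l + 1) * ∫ u in L..(2 * L), φ u * (u ^ (l + 1))⁻¹ := by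
  have h1 : ∫ u in L..(2 * L), φ L * ((2 * L) ^ (l + 1))⁻¹ ≤
      ∫ u in L..(2 * L), φ u * (u ^ (l + 1))⁻¹ := by
    refine intervalIntegral.integral_mono_on (by linarith) (by simp)
      (hφ.intervalIntegrable_mul (continuousOn_inv_pow _) hL (by linarith)) fun u hu => ?_
    have hu0 : 0 < u := hL.trans_le hu.1
    have := hφ0 u
    gcongr
    · exact hφ hu.1
    · exact hu.2
  rw [intervalIntegral.integral_const, smul_eq_mul] at h1
  have h2 : (2 * L - L) * (φ L * ((2 * L) ^ (l + 1))⁻¹) = φ L / L ^ l / 2 ^ (l + 1) := by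
    rw [mul_pow]; field_simp; ring
  rw [h2, div_le_iff₀ (by positivity)] at h1
  linarith

/-- Comparison of near-best local polynomials on nested intervals. -/
theorem exists_iterate_derivative_sub_le (k l : ℕ) {W : ℝ} (hW : 0 ≤ W) :
    ∃ K : ℝ, 0 < K ∧ ∀ (φ g : ℝ → ℝ) (A B : ℝ) (p : ℝ → ℝ → ℝ[X]), Monotone φ → (∀ u, 0 ≤ φ u) →
      (∀ a b, A ≤ a → a < b → b ≤ B → (p a b).natDegree < k ∧
        ∀ x ∈ Icc a b, |g x - (p a b).eval x| ≤ W * φ (b - a)) →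
      ∀ a b a' b', A ≤ a → a ≤ a' → a' < b' → b' ≤ b → b ≤ B → ∀ x ∈ Icc a' b',
        |(derivative^[l] (p a' b' - p a b)).eval x| ≤
          K * ∫ u in (b' - a')..(2 * (b - a)), φ u * (u ^ (l + 1))⁻¹ := by
  obtain ⟨M, hM, HM⟩ := exists_iterate_derivative_bound k l
  refine ⟨M * (2 * W) * 2 ^ l * 2 ^ (l + 1) + 1, by positivity, ?_⟩
  intro φ g A B p hφ hφ0 hp
  set K := M * (2 * W) * 2 ^ l * 2 ^ (l + 1) + 1 with hK
  have hK0 : 0 < K := by positivity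
  have hw0 (u : ℝ) (hu : 0 < u) : 0 ≤ (u ^ (l + 1))⁻¹ := by positivity
  have direct : ∀ a b a' b', A ≤ a → a ≤ a' → a' < b' → b' ≤ b → b ≤ B → b - a ≤ 2 * (b' - a') →
      ∀ x ∈ Icc a' b', |(derivative^[l] (p a' b' - p a b)).eval x| ≤
        K * ∫ u in (b - a)..(2 * (b - a)), φ u * (u ^ (l + 1))⁻¹ := by
    intro a b a' b' hA haa hab hbb hB h2 x hx
    have hL' : 0 < b' - a' := sub_pos.2 hab
    have hL : 0 < b - a := by linarith
    obtain ⟨d1, h1⟩ := hp a' b' (hA.trans haa) hab (hbb.trans hB)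
    obtain ⟨d2, h2'⟩ := hp a b hA (by linarith) hB
    have hd : (p a' b' - p a b).natDegree < k :=
      lt_of_le_of_lt (natDegree_sub_le _ _) (max_lt d1 d2)
    have hb := HM _ hd (2 * W * φ (b - a)) a' b' hab (fun y hy => by
      have e1 := h1 y hy
      have e2 := h2' y ⟨haa.trans hy.1, hy.2.trans hbb⟩
      have e3 : W * φ (b' - a') ≤ W * φ (b - a) := by
        gcongr
        exact hφ (by linarith)
      rw [eval_sub]
      rw [abs_le] at e1 e2 ⊢
      constructor <;> linarith [e1.1, e1.2, e2.1, e2.2]) x hx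
    have hI := hφ.le_integral_inv_pow hφ0 l hL
    have hI0 := integral_mul_nonneg_of_pos hφ0 hw0 hL (b := 2 * (b - a)) (by linarith)
    have hpos := hφ0 (b - a)
    calc _ ≤ M * (2 * W * φ (b - a)) / (b' - a') ^ l := hb
      _ ≤ M * (2 * W * φ (b - a)) / ((b - a) / 2) ^ l := by
          gcongr
          linarith
      _ = M * (2 * W) * 2 ^ l * (φ (b - a) / (b - a) ^ l) := by
          rw [div_pow]; field_simp
      _ ≤ M * (2 * W) * 2 ^ l * (2 ^ (l + 1) *
          ∫ u in (b - a)..(2 * (b - a)), φ u * (u ^ (l + 1))⁻¹) := by gcongr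
      _ ≤ _ := by rw [hK, add_mul, ← mul_assoc]; linarith
  have key (N : ℕ) : ∀ a b a' b', A ≤ a → a ≤ a' → a' < b' → b' ≤ b → b ≤ B →
      b - a ≤ 2 ^ N * (b' - a') → ∀ x ∈ Icc a' b', |(derivative^[l] (p a' b' - p a b)).eval x| ≤
        K * ∫ u in (b' - a')..(2 * (b - a)), φ u * (u ^ (l + 1))⁻¹ := by
    have base : ∀ a b a' b', A ≤ a → a ≤ a' → a' < b' → b' ≤ b → b ≤ B → b - a ≤ 2 * (b' - a') →
        ∀ x ∈ Icc a' b', |(derivative^[l] (p a' b' - p a b)).eval x| ≤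
          K * ∫ u in (b' - a')..(2 * (b - a)), φ u * (u ^ (l + 1))⁻¹ := by
      intro a b a' b' hA haa hab hbb hB h2 x hx
      refine (direct a b a' b' hA haa hab hbb hB h2 x hx).trans ?_
      gcongr
      exact hφ.integral_mul_mono_interval hφ0 (continuousOn_inv_pow _) hw0 (sub_pos.2 hab)
        (by linarith) (by linarith) le_rfl
    induction N with
    | zero =>
      intro a b a' b' hA haa hab hbb hB h2
      exact base a b a' b' hA haa hab hbb hB (by linarith)
    | succ N ih =>
      intro a b a' b' hA haa hab hbb hB h2 x hx
      rcases le_or_gt (b - a) (2 * (b' - a')) with h | h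
      · exact base a b a' b' hA haa hab hbb hB h x hx
      set c := max a (b' - (b - a) / 2) with hc
      have hc1 : a ≤ c := le_max_left _ _
      have hc2 : b' - (b - a) / 2 ≤ c := le_max_right _ _
      have hc3 : c ≤ a' := max_le haa (by linarith)
      have hc4 : c + (b - a) / 2 ≤ b := by
        have : c ≤ b - (b - a) / 2 := max_le (by linarith) (by linarith)
        linarith
      have i1 := ih c (c + (b - a) / 2) a' b' (hA.trans hc1) hc3 hab (by linarith) (by linarith)
        (by rw [pow_succ] at h2; linarith) x hx
      have i2 := direct a b c (c + (b - a) / 2) hA hc1 (by linarith) hc4 hB (by linarith) x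
        ⟨hc3.trans hx.1, by linarith [hx.2]⟩
      have e1 : 2 * (c + (b - a) / 2 - c) = b - a := by ring
      rw [e1] at i1
      have hadd := intervalIntegral.integral_add_adjacent_intervals
        (hφ.intervalIntegrable_mul (continuousOn_inv_pow (l + 1)) (sub_pos.2 hab)
          (by linarith : b' - a' ≤ b - a))
        (hφ.intervalIntegrable_mul (continuousOn_inv_pow (l + 1)) (by linarith : 0 < b - a)
          (by linarith : b - a ≤ 2 * (b - a)))
      rw [← hadd, mul_add]
      have e2 : p a' b' - p a b =
          (p a' b' - p c (c + (b - a) / 2)) + (p c (c + (b - a) / 2) - p a b) := by ring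
      rw [e2, iterate_map_add, eval_add]
      exact (abs_add_le _ _).trans (add_le_add i1 i2)
  intro a b a' b' hA haa hab hbb hB
  obtain ⟨N, hN⟩ := pow_unbounded_of_one_lt ((b - a) / (b' - a')) (one_lt_two : (1 : ℝ) < 2)
  exact key N a b a' b' hA haa hab hbb hB ((div_lt_iff₀ (sub_pos.2 hab)).1 hN).le

/-- The weight `u ^ r ∏ 1 / max u |z i - z j|` over the knots `z p, …, z q`. -/
noncomputable def knotWeight (z : ℕ → ℝ) (r p q j : ℕ) (u : ℝ) : ℝ :=
  u ^ r * ∏ i ∈ Finset.Icc p q, (max u |z i - z j|)⁻¹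

/-- The sum over `j` of the integrals of `φ` against `knotWeight`, from `z (j + r + 1) - z j` to
twice the length of the knot sequence. -/
noncomputable def knotSum (φ : ℝ → ℝ) (z : ℕ → ℝ) (r p q : ℕ) : ℝ :=
  ∑ j ∈ Finset.Ico p (q - r),
    ∫ u in (z (j + r + 1) - z j)..(2 * (z q - z p)), φ u * knotWeight z r p q j u

theorem continuousOn_knotWeight (z : ℕ → ℝ) (r p q j : ℕ) :
    ContinuousOn (knotWeight z r p q j) (Ioi 0) := by
  refine (continuous_pow r).continuousOn.mul (continuousOn_finsetProd _ fun i _ => ?_)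
  refine ContinuousOn.inv₀ (by fun_prop) fun u hu => ?_
  exact (lt_max_of_lt_left hu).ne'

theorem knotWeight_nonneg (z : ℕ → ℝ) (r p q j : ℕ) {u : ℝ} (hu : 0 < u) :
    0 ≤ knotWeight z r p q j u :=
  mul_nonneg (by positivity) (Finset.prod_nonneg fun _ _ => by positivity)

theorem knotWeight_of_le {z : ℕ → ℝ} (hz : Monotone z) {r p q : ℕ} (j : ℕ) (hpj : p ≤ j)
    (hjq : j ≤ q) {u : ℝ} (hu : z q - z p ≤ u) :
    knotWeight z r p q j u = u ^ r * (u ^ (q + 1 - p))⁻¹ := by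
  rw [knotWeight, Finset.prod_congr rfl (g := fun _ => u⁻¹), Finset.prod_const, Nat.card_Icc,
    inv_pow]
  intro i hi
  rw [Finset.mem_Icc] at hi
  rw [max_eq_left]
  refine (abs_le.2 ⟨?_, ?_⟩).trans hu
  · linarith [hz hi.1, hz hjq]
  · linarith [hz hi.2, hz hpj]

/-- Removing a knot from the weight. -/
theorem knotWeight_le {z : ℕ → ℝ} (hz : Monotone z) {r p q p' q' e j : ℕ}
    (he : Finset.Icc p q = insert e (Finset.Icc p' q')) (hne : e ∉ Finset.Icc p' q')
    (hpj : p ≤ j) (hjq : j ≤ q) {u : ℝ} (hu0 : 0 < u) (hu : u ≤ 2 * (z q - z p)) :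
    knotWeight z r p' q' j u ≤ 2 * (z q - z p) * knotWeight z r p q j u := by
  have hmem : e ∈ Finset.Icc p q := by rw [he]; exact Finset.mem_insert_self _ _
  rw [Finset.mem_Icc] at hmem
  have hw : knotWeight z r p q j u = (max u |z e - z j|)⁻¹ * knotWeight z r p' q' j u := by
    rw [knotWeight, he, Finset.prod_insert hne, knotWeight]; ring
  have hm0 : 0 < max u |z e - z j| := lt_max_of_lt_left hu0
  have hm : max u |z e - z j| ≤ 2 * (z q - z p) := by
    refine max_le hu ((abs_le.2 ⟨?_, ?_⟩ : |z e - z j| ≤ z q - z p).trans ?_)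
    · linarith [hz hmem.1, hz hjq]
    · linarith [hz hmem.2, hz hpj]
    · linarith
  have hk := knotWeight_nonneg z r p' q' j hu0
  rw [hw, ← mul_assoc]
  refine le_mul_of_one_le_left hk ?_
  rw [← div_eq_mul_inv]
  exact (one_le_div hm0).2 hm

/-- The data of local polynomial approximation of `f^{(r)}`: on each subinterval `[a,b]` of `[A,B]`,
the `r`-th derivative of `P a b` approximates `f^{(r)}` up to `W * φ (b - a)`. -/
structure IsLocalApprox (r k : ℕ) (W : ℝ) (φ f : ℝ → ℝ) (A B : ℝ) (P : ℝ → ℝ → ℝ[X]) : Prop where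
  mono : Monotone φ
  nonneg : ∀ u, 0 ≤ φ u
  lt : A < B
  contDiffOn : ContDiffOn ℝ r f (Icc A B)
  approx : ∀ a b, A ≤ a → a < b → b ≤ B → (derivative^[r] (P a b)).natDegree < k ∧
    ∀ x ∈ Icc a b, |iteratedDerivWithin r f (Icc A B) x - (derivative^[r] (P a b)).eval x| ≤
      W * φ (b - a)

/-- `z` is an admissible knot sequence `z 0 ≤ … ≤ z m` in `[A,B]` with multiplicities at most
`r + 1`. -/
structure IsKnotSequence (r m : ℕ) (A B : ℝ) (z : ℕ → ℝ) : Prop where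
  mono : Monotone z
  mem : ∀ i, z i ∈ Icc A B
  lt : ∀ i, i + r + 1 ≤ m → z i < z (i + r + 1)

section
variable {r k m : ℕ} {W : ℝ} {φ f : ℝ → ℝ} {A B : ℝ} {P : ℝ → ℝ → ℝ[X]} {z : ℕ → ℝ}

theorem knotSum_term_nonneg (hφ0 : ∀ u, 0 ≤ φ u) (hz : IsKnotSequence r m A B z) {p q : ℕ}
    (hqm : q ≤ m) {j : ℕ} (hj : j ∈ Finset.Ico p (q - r)) :
    0 ≤ ∫ u in (z (j + r + 1) - z j)..(2 * (z q - z p)), φ u * knotWeight z r p q j u := by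
  rw [Finset.mem_Ico] at hj
  have h1 : z j < z (j + r + 1) := hz.lt j (by omega)
  have h2 : z p ≤ z j := hz.mono hj.1
  have h3 : z (j + r + 1) ≤ z q := hz.mono (by omega)
  exact integral_mul_nonneg_of_pos hφ0 (fun u hu => knotWeight_nonneg _ _ _ _ _ hu)
    (by linarith) (by linarith)

/-- Passing to a subsequence of knots with one end knot removed. -/
theorem knotSum_le (hφ : Monotone φ) (hφ0 : ∀ u, 0 ≤ φ u) (hz : IsKnotSequence r m A B z)
    {p q p' q' e : ℕ} (he : Finset.Icc p q = insert e (Finset.Icc p' q'))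
    (hne : e ∉ Finset.Icc p' q') (hpp : p ≤ p') (hqq : q' ≤ q) (hqm : q ≤ m) :
    knotSum φ z r p' q' ≤ 2 * (z q - z p) * knotSum φ z r p q := by
  have hsub : Finset.Ico p' (q' - r) ⊆ Finset.Ico p (q - r) :=
    Finset.Ico_subset_Ico hpp (by omega)
  have hp : z p ≤ z p' := hz.mono hpp
  have hq : z q' ≤ z q := hz.mono hqq
  rcases Finset.eq_empty_or_nonempty (Finset.Ico p' (q' - r)) with hem | ⟨j₀, hj₀⟩
  · have h0 : 0 ≤ z q - z p := by
      have : p ∈ Finset.Icc p q ∨ q < p := by simp; omega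
      rcases this with h | h
      · linarith [hz.mono (Finset.mem_Icc.1 h).2]
      · have := Finset.Icc_eq_empty (not_le.2 h)
        rw [this] at he
        exact absurd he.symm (Finset.insert_ne_empty _ _)
    rw [knotSum, hem, Finset.sum_empty]
    refine mul_nonneg (by linarith) (Finset.sum_nonneg fun j hj => knotSum_term_nonneg hφ0 hz hqm hj)
  · rw [knotSum, knotSum, Finset.mul_sum]
    have hpq : 0 ≤ z q - z p := by
      rw [Finset.mem_Ico] at hj₀
      linarith [hz.mono (show p ≤ q by omega)]
    refine (Finset.sum_le_sum fun j hj => ?_).trans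
      (Finset.sum_le_sum_of_subset_of_nonneg hsub fun j hj _ =>
        mul_nonneg (by linarith) (knotSum_term_nonneg hφ0 hz hqm hj))
    rw [Finset.mem_Ico] at hj
    have h1 : z j < z (j + r + 1) := hz.lt j (by omega)
    have h2 : z p' ≤ z j := hz.mono hj.1
    have h3 : z (j + r + 1) ≤ z q' := hz.mono (by omega)
    have hpos : 0 < z (j + r + 1) - z j := by linarith
    rw [← intervalIntegral.integral_const_mul]
    calc _ ≤ ∫ u in (z (j + r + 1) - z j)..(2 * (z q - z p)), φ u * knotWeight z r p' q' j u :=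
          hφ.integral_mul_mono_interval hφ0 (continuousOn_knotWeight _ _ _ _ _)
            (fun u hu => knotWeight_nonneg _ _ _ _ _ hu) hpos le_rfl (by linarith) (by linarith)
      _ ≤ _ := by
          refine intervalIntegral.integral_mono_on (by linarith)
            (hφ.intervalIntegrable_mul (continuousOn_knotWeight _ _ _ _ _) hpos (by linarith))
            ((hφ.intervalIntegrable_mul (continuousOn_knotWeight _ _ _ _ _) hpos
              (by linarith)).const_mul _) fun u hu => ?_
          have := knotWeight_le (r := r) hz.mono he hne (hpp.trans hj.1) (by omega : j ≤ q)
            (hpos.trans_le hu.1) hu.2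
          calc _ ≤ φ u * (2 * (z q - z p) * knotWeight z r p q j u) :=
                mul_le_mul_of_nonneg_left this (hφ0 u)
            _ = _ := by ring

theorem integral_inv_pow_le_knotSum (hφ : Monotone φ) (hφ0 : ∀ u, 0 ≤ φ u)
    (hz : IsKnotSequence r m A B z) {p q p' q' e n : ℕ}
    (he : Finset.Icc p q = insert e (Finset.Icc p' q'))
    (hne : e ∉ Finset.Icc p' q') (hpp : p ≤ p') (hqq : q' ≤ q) (hqm : q ≤ m)
    (hn : p' + n = q') (hrn : r + 1 ≤ n) :
    ∫ u in (z q' - z p')..(2 * (z q - z p)), φ u * (u ^ (n - r + 1))⁻¹ ≤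
      2 * (z q - z p) * knotSum φ z r p q := by
  have hp : z p ≤ z p' := hz.mono hpp
  have hq : z q' ≤ z q := hz.mono hqq
  have h1 : z p' < z (p' + r + 1) := hz.lt p' (by omega)
  have h3 : z (p' + r + 1) ≤ z q' := hz.mono (by omega)
  have hpos : 0 < z (p' + r + 1) - z p' := by linarith
  have hpos' : 0 < z q' - z p' := by linarith
  have hj : p' ∈ Finset.Ico p (q - r) := Finset.mem_Ico.2 ⟨hpp, by omega⟩
  calc _ ≤ ∫ u in (z q' - z p')..(2 * (z q - z p)),
        2 * (z q - z p) * (φ u * knotWeight z r p q p' u) := by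
        refine intervalIntegral.integral_mono_on (by linarith)
            (hφ.intervalIntegrable_mul (continuousOn_inv_pow _) hpos' (by linarith))
            ((hφ.intervalIntegrable_mul (continuousOn_knotWeight _ _ _ _ _) hpos'
              (by linarith)).const_mul _) fun u hu => ?_
        have hu0 : 0 < u := hpos'.trans_le hu.1
        have h := knotWeight_le (r := r) hz.mono he hne hpp (by omega : p' ≤ q) hu0 hu.2
        rw [knotWeight_of_le hz.mono _ le_rfl (by omega) hu.1] at h
        have e1 : u ^ r * (u ^ (q' + 1 - p'))⁻¹ = (u ^ (n - r + 1))⁻¹ := by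
          have : q' + 1 - p' = r + (n - r + 1) := by omega
          rw [this, pow_add]
          field_simp
        rw [e1] at h
        calc _ ≤ φ u * (2 * (z q - z p) * knotWeight z r p q p' u) :=
                mul_le_mul_of_nonneg_left h (hφ0 u)
            _ = _ := by ring
    _ = 2 * (z q - z p) * ∫ u in (z q' - z p')..(2 * (z q - z p)), φ u * knotWeight z r p q p' u := by
        rw [intervalIntegral.integral_const_mul]
    _ ≤ 2 * (z q - z p) * ∫ u in (z (p' + r + 1) - z p')..(2 * (z q - z p)),
          φ u * knotWeight z r p q p' u := by
        refine mul_le_mul_of_nonneg_left ?_ (by linarith)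
        exact hφ.integral_mul_mono_interval hφ0 (continuousOn_knotWeight _ _ _ _ _)
            (fun u hu => knotWeight_nonneg _ _ _ _ _ hu) hpos (by linarith) (by linarith) le_rfl
    _ ≤ _ := by
        refine mul_le_mul_of_nonneg_left ?_ (by linarith)
        exact Finset.single_le_sum (f := fun j => ∫ u in (z (j + r + 1) - z j)..(2 * (z q - z p)),
          φ u * knotWeight z r p q j u) (fun j hj => knotSum_term_nonneg hφ0 hz hqm hj) hj

theorem iteratedDerivWithin_sub_polynomial {S : Set ℝ} (hS : UniqueDiffOn ℝ S)
    (hf : ContDiffOn ℝ r f S) (Q : ℝ[X]) {y : ℝ} (hy : y ∈ S) :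
    iteratedDerivWithin r (fun t => f t - Q.eval t) S y =
      iteratedDerivWithin r f S y - (derivative^[r] Q).eval y := by
  rw [← iteratedDerivWithin_polynomial_eval hS Q r hy]
  exact iteratedDerivWithin_sub hy hS (hf _ hy) (Q.contDiff_eval.contDiffOn (s := S) _ hy)

/-- The divided difference over the knots `z p, …, z (p + n)`. -/
noncomputable def windowDifference (S : Set ℝ) (f : ℝ → ℝ) (z : ℕ → ℝ) (p n : ℕ) : ℝ :=
  dividedDifference S f n fun i => z (p + i)

theorem windowDifference_succ (S : Set ℝ) (f : ℝ → ℝ) (z : ℕ → ℝ) {p n : ℕ}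
    (h : z p < z (p + (n + 1))) :
    windowDifference S f z p (n + 1) =
      (windowDifference S f z (p + 1) n - windowDifference S f z p n) / (z (p + (n + 1)) - z p) := by
  unfold windowDifference
  rw [dividedDifference_of_lt _ _ (by simpa using h)]
  have e (i : Fin (n + 1)) : p + ((i : ℕ) + 1) = p + 1 + i := by omega
  simp [e]

theorem windowDifference_sub (hS : UniqueDiffOn ℝ (Icc A B)) (hz : IsKnotSequence r m A B z)
    {f g : ℝ → ℝ} (hf : ContDiffOn ℝ r f (Icc A B)) (hg : ContDiffOn ℝ r g (Icc A B)) {p n : ℕ}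
    (h : p + n ≤ m) :
    windowDifference (Icc A B) (fun t => f t - g t) z p n =
      windowDifference (Icc A B) f z p n - windowDifference (Icc A B) g z p n := by
  refine dividedDifference_sub hS hf hg (fun i j hij => hz.mono ?_) (fun i => hz.mem _) ?_
  · have : (i : ℕ) ≤ j := hij
    omega
  · intro i j hij
    have := hz.lt (p + i) (by omega)
    rwa [show p + (i : ℕ) + r + 1 = p + j by omega] at this

theorem abs_windowDifference_le {S : Set ℝ} (hS : UniqueDiffOn ℝ S) (hSc : S.OrdConnected)
    (hz : Monotone z) (hzS : ∀ i, z i ∈ S) {p n : ℕ} {g : ℝ → ℝ} (hg : ContDiffOn ℝ n g S) {M : ℝ}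
    (hM : ∀ y ∈ Icc (z p) (z (p + n)), |iteratedDerivWithin n g S y| ≤ M) :
    |windowDifference S g z p n| ≤ 2 ^ n * M := by
  refine abs_dividedDifference_le hS hSc hg (fun i j hij => hz ?_) (fun i => hzS _) (by simpa using hM)
  have : (i : ℕ) ≤ j := hij
  omega

/-- The main estimate: divided differences of `f` minus its local polynomial approximation. -/
theorem exists_abs_windowDifference_le (r k l : ℕ) {W : ℝ} (hW : 0 ≤ W) :
    ∃ K : ℝ, 0 < K ∧ ∀ (φ f : ℝ → ℝ) (A B : ℝ) (P : ℝ → ℝ → ℝ[X]) (m : ℕ) (z : ℕ → ℝ),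
      IsLocalApprox r k W φ f A B P → IsKnotSequence r m A B z → ∀ p, p + (r + 1 + l) ≤ m →
      |windowDifference (Icc A B)
        (fun t => f t - (P (z p) (z (p + (r + 1 + l)))).eval t) z p (r + 1 + l)| ≤
        K * knotSum φ z r p (p + (r + 1 + l)) := by
  induction l with
  | zero =>
    refine ⟨2 ^ (r + 1) * W * 2 ^ 2 + 1, by positivity, ?_⟩
    intro φ f A B P m z hP hz p hpm
    have hS : UniqueDiffOn ℝ (Icc A B) := uniqueDiffOn_Icc hP.lt
    simp only [add_zero] at hpm ⊢
    set q := p + (r + 1) with hq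
    have hpq : z p < z q := hz.lt p hpm
    have hL : 0 < z q - z p := sub_pos.2 hpq
    obtain ⟨-, hap⟩ := hP.approx (z p) (z q) (hz.mem p).1 hpq (hz.mem q).2
    set Q := P (z p) (z q) with hQ
    have hfQ : ContDiffOn ℝ r (fun t => f t - Q.eval t) (Icc A B) :=
      hP.contDiffOn.sub Q.contDiff_eval.contDiffOn
    have hb (p' : ℕ) (hp1 : p ≤ p') (hp2 : p' + r ≤ q) :
        |windowDifference (Icc A B) (fun t => f t - Q.eval t) z p' r| ≤
          2 ^ r * (W * φ (z q - z p)) := by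
      refine abs_windowDifference_le hS ordConnected_Icc hz.mono hz.mem hfQ fun y hy => ?_
      have hy' : y ∈ Icc (z p) (z q) := ⟨(hz.mono hp1).trans hy.1, hy.2.trans (hz.mono hp2)⟩
      rw [iteratedDerivWithin_sub_polynomial hS hP.contDiffOn Q
        ⟨(hz.mem p).1.trans hy'.1, hy'.2.trans (hz.mem q).2⟩]
      exact hap y hy'
    have h1 := hb (p + 1) (by omega) (by omega)
    have h2 := hb p le_rfl (by omega)
    have hsum : knotSum φ z r p q = ∫ u in (z q - z p)..(2 * (z q - z p)), φ u * (u ^ (1 + 1))⁻¹ := by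
      have : Finset.Ico p (q - r) = {p} := by
        ext i; rw [Finset.mem_Ico, Finset.mem_singleton]; omega
      rw [knotSum, this, Finset.sum_singleton, add_assoc, ← hq]
      refine intervalIntegral.integral_congr fun u hu => ?_
      rw [uIcc_of_le (by linarith)] at hu
      have hu0 : 0 < u := hL.trans_le hu.1
      rw [knotWeight_of_le hz.mono p le_rfl (by omega) hu.1, show q + 1 - p = r + 2 by omega, pow_add]
      field_simp
    have hI := hP.mono.le_integral_inv_pow hP.nonneg 1 hL
    rw [← hsum] at hI
    have hI0 : 0 ≤ knotSum φ z r p q :=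
      Finset.sum_nonneg fun j hj => knotSum_term_nonneg hP.nonneg hz hpm hj
    rw [windowDifference_succ _ _ _ hpq, abs_div, abs_of_pos hL]
    calc _ ≤ (2 ^ r * (W * φ (z q - z p)) + 2 ^ r * (W * φ (z q - z p))) / (z q - z p) := by
          gcongr
          exact (abs_sub _ _).trans (add_le_add h1 h2)
      _ = 2 ^ (r + 1) * W * (φ (z q - z p) / (z q - z p) ^ 1) := by ring
      _ ≤ 2 ^ (r + 1) * W * (2 ^ (1 + 1) * knotSum φ z r p q) := by gcongr
      _ = 2 ^ (r + 1) * W * 2 ^ 2 * knotSum φ z r p q := by ring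
      _ ≤ _ := by gcongr; linarith
  | succ l ih =>
    obtain ⟨K, hK, ih⟩ := ih
    obtain ⟨M, hM, HM⟩ := exists_iterate_derivative_sub_le k (l + 1) hW
    set n := r + 1 + l with hn
    refine ⟨4 * (K + 2 ^ n * M), by positivity, ?_⟩
    intro φ f A B P m z hP hz p hpm
    have hS : UniqueDiffOn ℝ (Icc A B) := uniqueDiffOn_Icc hP.lt
    rw [show r + 1 + (l + 1) = n + 1 by omega] at hpm ⊢
    set q := p + (n + 1) with hq
    have hpq : z p < z q := (hz.lt p (by omega)).trans_le (hz.mono (by omega))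
    have hL : 0 < z q - z p := sub_pos.2 hpq
    set Q := P (z p) (z q) with hQ
    have hI0 : 0 ≤ knotSum φ z r p q :=
      Finset.sum_nonneg fun j hj => knotSum_term_nonneg hP.nonneg hz hpm hj
    have step (p' e : ℕ) (he : Finset.Icc p q = insert e (Finset.Icc p' (p' + n)))
        (hne : e ∉ Finset.Icc p' (p' + n)) (hpp : p ≤ p') (hqq : p' + n ≤ q) :
        |windowDifference (Icc A B) (fun t => f t - Q.eval t) z p' n| ≤
          2 * (K + 2 ^ n * M) * ((z q - z p) * knotSum φ z r p q) := by
      set Q' := P (z p') (z (p' + n)) with hQ'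
      have hpq' : z p' < z (p' + n) := (hz.lt p' (by omega)).trans_le (hz.mono (by omega))
      have e1 : windowDifference (Icc A B) (fun t => f t - Q.eval t) z p' n =
          windowDifference (Icc A B) (fun t => f t - Q'.eval t) z p' n +
            windowDifference (Icc A B) (fun t => (Q' - Q).eval t) z p' n := by
        have e2 := windowDifference_sub hS hz (f := fun t => f t - Q.eval t)
          (g := fun t => (Q' - Q).eval t) (hP.contDiffOn.sub Q.contDiff_eval.contDiffOn)
          (Q' - Q).contDiff_eval.contDiffOn (p := p') (n := n) (by omega)
        rw [← sub_eq_iff_eq_add, ← e2]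
        congr 1
        ext t
        rw [eval_sub]; ring
      have b1 := ih φ f A B P m z hP hz p' (by omega)
      have b2 : |windowDifference (Icc A B) (fun t => (Q' - Q).eval t) z p' n| ≤
          2 ^ n * (M * ∫ u in (z (p' + n) - z p')..(2 * (z q - z p)), φ u * (u ^ (l + 1 + 1))⁻¹) := by
        refine abs_windowDifference_le hS ordConnected_Icc hz.mono hz.mem
          (Q' - Q).contDiff_eval.contDiffOn fun y hy => ?_
        rw [iteratedDerivWithin_polynomial_eval hS _ _
          ⟨(hz.mem p').1.trans hy.1, hy.2.trans (hz.mem _).2⟩]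
        have := HM φ (iteratedDerivWithin r f (Icc A B)) A B (fun a b => derivative^[r] (P a b))
          hP.mono hP.nonneg hP.approx (z p) (z q) (z p') (z (p' + n)) (hz.mem p).1 (hz.mono hpp) hpq'
          (hz.mono hqq) (hz.mem q).2 y hy
        rwa [← iterate_map_sub, ← Function.iterate_add_apply, show l + 1 + r = n by omega] at this
      have c1 := knotSum_le hP.mono hP.nonneg hz he hne hpp hqq hpm
      have c2 := integral_inv_pow_le_knotSum hP.mono hP.nonneg hz he hne hpp hqq hpm rfl (by omega)
      rw [show n - r + 1 = l + 1 + 1 by omega] at c2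
      rw [e1]
      calc _ ≤ K * knotSum φ z r p' (p' + n) + 2 ^ n * (M *
            ∫ u in (z (p' + n) - z p')..(2 * (z q - z p)), φ u * (u ^ (l + 1 + 1))⁻¹) :=
            (abs_add_le _ _).trans (add_le_add b1 b2)
        _ ≤ K * (2 * (z q - z p) * knotSum φ z r p q) +
            2 ^ n * (M * (2 * (z q - z p) * knotSum φ z r p q)) := by gcongr
        _ = _ := by ring
    have s1 := step (p + 1) p (by ext i; simp only [Finset.mem_Icc, Finset.mem_insert]; omega)
      (by simp) (by omega) (by omega)
    have s2 := step p q (by ext i; simp only [Finset.mem_Icc, Finset.mem_insert]; omega)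
      (by simp only [Finset.mem_Icc]; omega) le_rfl (by omega)
    rw [windowDifference_succ _ _ _ hpq, abs_div, abs_of_pos hL, div_le_iff₀ hL]
    refine (abs_sub _ _).trans ((add_le_add s1 s2).trans (le_of_eq ?_))
    ring

end

theorem exists_iterate_derivative_eq (r : ℕ) {k : ℕ} {p : ℝ[X]} (hp : p.natDegree < k) :
    ∃ P : ℝ[X], derivative^[r] P = p ∧ P.natDegree < k + r := by
  induction r with
  | zero => exact ⟨p, rfl, hp⟩
  | succ r ih =>
    obtain ⟨Q, hQ, hQd⟩ := ih
    refine ⟨∑ i ∈ Finset.range (k + r), C (Q.coeff i / (i + 1)) * X ^ (i + 1), ?_, ?_⟩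
    · rw [Function.iterate_succ_apply, ← hQ]
      congr 1
      conv_rhs => rw [Q.as_sum_range' (k + r) hQd]
      rw [derivative_sum]
      refine Finset.sum_congr rfl fun i _ => ?_
      rw [derivative_C_mul_X_pow, ← C_mul_X_pow_eq_monomial]
      have : (i : ℝ) + 1 ≠ 0 := by positivity
      congr 2
      push_cast
      field_simp
    · refine Order.lt_succ_of_le (b := k + r) (natDegree_sum_le_of_forall_le _ _ fun i hi =>
        (natDegree_C_mul_X_pow_le _ _).trans ?_)
      exact Finset.mem_range.1 hi

section
variable {k : ℕ} {g : ℝ → ℝ} {a b : ℝ}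

theorem bddAbove_modulusOfSmoothness (hg : ContinuousOn g (Icc a b)) (t : ℝ) :
    BddAbove {y : ℝ | ∃ u ∈ Ioc (0 : ℝ) t, ∃ x ∈ Icc a b, y = |symmDifference k u g x a b|} := by
  obtain ⟨M, hM⟩ := isCompact_Icc.exists_bound_of_continuousOn hg
  refine ⟨∑ i ∈ Finset.range (k + 1), (k.choose i : ℝ) * |M|, ?_⟩
  rintro y ⟨u, hu, x, hx, rfl⟩
  unfold symmDifference
  split_ifs with h
  · refine (Finset.abs_sum_le_sum_abs _ _).trans (Finset.sum_le_sum fun i hi => ?_)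
    have hik : (i : ℝ) ≤ k := by exact_mod_cast Nat.lt_succ_iff.1 (Finset.mem_range.1 hi)
    rw [abs_mul, abs_mul, abs_pow, abs_neg, abs_one, one_pow, one_mul, Nat.abs_cast]
    refine mul_le_mul_of_nonneg_left ((hM _ ⟨?_, ?_⟩).trans (le_abs_self M)) (Nat.cast_nonneg _)
    · have : (k - i) * u ≥ 0 := mul_nonneg (by linarith) hu.1.le
      nlinarith [h.1.1]
    · have : i * u ≥ 0 := mul_nonneg (by positivity) hu.1.le
      nlinarith [h.2.2]
  · rw [abs_zero]
    exact Finset.sum_nonneg fun i _ => by positivity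

theorem modulusOfSmoothness_nonneg (t : ℝ) : 0 ≤ modulusOfSmoothness k g a b t := by
  refine Real.sSup_nonneg ?_
  rintro y ⟨u, hu, x, hx, rfl⟩
  exact abs_nonneg _

theorem monotone_modulusOfSmoothness (hab : a ≤ b) (hg : ContinuousOn g (Icc a b)) :
    Monotone (modulusOfSmoothness k g a b) := by
  intro s t hst
  rcases le_or_gt s 0 with h | h
  · have : modulusOfSmoothness k g a b s = 0 := by
      rw [modulusOfSmoothness]
      convert Real.sSup_empty
      ext y
      simp only [mem_ofPred_eq, mem_empty_iff_false, iff_false]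
      rintro ⟨u, hu, -⟩
      linarith [hu.1, hu.2]
    rw [this]
    exact modulusOfSmoothness_nonneg t
  · refine csSup_le_csSup (bddAbove_modulusOfSmoothness hg t) ?_ ?_
    · exact ⟨_, s, ⟨h, le_rfl⟩, a, ⟨le_rfl, hab⟩, rfl⟩
    · rintro y ⟨u, hu, x, hx, rfl⟩
      exact ⟨u, ⟨hu.1, hu.2.trans hst⟩, x, hx, rfl⟩

theorem abs_fwdDiff_le_modulusOfSmoothness (hg : ContinuousOn g (Icc a b)) {x u t : ℝ}
    (hu : 0 < u) (hut : u ≤ t) (hx : a ≤ x) (hxu : x + k * u ≤ b) :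
    |(fwdDiff u)^[k] g x| ≤ modulusOfSmoothness k g a b t := by
  have hku : 0 ≤ (k : ℝ) * u := by positivity
  refine le_csSup (bddAbove_modulusOfSmoothness hg t)
    ⟨u, ⟨hu, hut⟩, x + k / 2 * u, ⟨by linarith, by linarith⟩, ?_⟩
  rw [symmDifference, if_pos ⟨⟨by linarith, by linarith⟩, ⟨by linarith, by linarith⟩⟩,
    fwdDiff_iter_eq_sum, ← Finset.sum_range_reflect]
  congr 1
  refine Finset.sum_congr rfl fun i hi => ?_
  have hik : i ≤ k := Nat.lt_succ_iff.1 (Finset.mem_range.1 hi)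
  rw [show k + 1 - 1 - i = k - i by omega, Nat.sub_sub_self hik, Nat.choose_symm hik,
    Nat.cast_sub hik]
  congr 2
  ring

end

/-- Existence of near-best local polynomial approximations in terms of the modulus of smoothness. -/
theorem exists_isLocalApprox {k : ℕ} (hk : 1 ≤ k) :
    ∃ W : ℝ, 0 < W ∧ ∀ (r : ℕ) (f : ℝ → ℝ) (A B : ℝ), A < B → ContDiffOn ℝ r f (Icc A B) →
      ∃ P : ℝ → ℝ → ℝ[X],
        IsLocalApprox r k W (modulusOfSmoothness k (iteratedDerivWithin r f (Icc A B)) A B) f A B P ∧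
          ∀ a b, A ≤ a → a < b → b ≤ B → (P a b).natDegree < k + r := by
  obtain ⟨W, hW, H⟩ := exists_polynomial_approx hk
  refine ⟨W, hW, fun r f A B hAB hf => ?_⟩
  have hg : ContinuousOn (iteratedDerivWithin r f (Icc A B)) (Icc A B) :=
    hf.continuousOn_iteratedDerivWithin le_rfl (uniqueDiffOn_Icc hAB)
  set g := iteratedDerivWithin r f (Icc A B)
  have hex (a b : ℝ) : ∃ P : ℝ[X], A ≤ a → a < b → b ≤ B → ((derivative^[r] P).natDegree < k ∧
      ∀ x ∈ Icc a b, |g x - (derivative^[r] P).eval x| ≤ W * modulusOfSmoothness k g A B (b - a)) ∧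
        P.natDegree < k + r := by
    by_cases h : A ≤ a ∧ a < b ∧ b ≤ B
    · obtain ⟨hA, hab, hB⟩ := h
      obtain ⟨p, hpd, hp⟩ := H a b hab g (hg.mono (Icc_subset_Icc hA hB))
        (modulusOfSmoothness k g A B (b - a)) (modulusOfSmoothness_nonneg _) (by
          intro x u hu hx hxu
          have : u ≤ k * u := le_mul_of_one_le_left hu.le (by exact_mod_cast hk)
          exact abs_fwdDiff_le_modulusOfSmoothness hg hu (by linarith) (hA.trans hx) (hxu.trans hB))
      obtain ⟨P, hP, hPd⟩ := exists_iterate_derivative_eq r hpd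
      exact ⟨P, fun _ _ _ => ⟨by rw [hP]; exact ⟨hpd, hp⟩, hPd⟩⟩
    · exact ⟨0, fun h1 h2 h3 => absurd ⟨h1, h2, h3⟩ h⟩
  choose P hP using hex
  exact ⟨P, ⟨monotone_modulusOfSmoothness hAB.le hg, modulusOfSmoothness_nonneg, hAB, hf,
    fun a b h1 h2 h3 => (hP a b h1 h2 h3).1⟩, fun a b h1 h2 h3 => (hP a b h1 h2 h3).2⟩

/-- The knots `x` continued to all natural indices by the last knot. -/
def extendKnots {m : ℕ} (x : Fin (m + 1) → ℝ) (i : ℕ) : ℝ := x ⟨min i m, by omega⟩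

theorem extendKnots_val {m : ℕ} (x : Fin (m + 1) → ℝ) (i : Fin (m + 1)) :
    extendKnots x i = x i := by
  rw [extendKnots]
  congr 1
  ext
  simp only
  omega

theorem isKnotSequence_extendKnots {m r : ℕ} {x : Fin (m + 1) → ℝ} (hx : Monotone x)
    (hmul : ∀ i j : Fin (m + 1), (j : ℕ) = (i : ℕ) + r + 1 → x i < x j) :
    IsKnotSequence r m (x 0) (x (Fin.last m)) (extendKnots x) where
  mono i j hij := hx (Fin.mk_le_mk.2 (min_le_min_right m hij))
  mem i := ⟨hx (Fin.zero_le _), hx (Fin.le_last _)⟩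
  lt i hi := hmul _ _ (by simp only; omega)

section
variable {m r : ℕ} {x : Fin (m + 1) → ℝ}

theorem sub_le_knotGap (hx : Monotone x) (p q : Fin (m + 1)) : x q - x p ≤ knotGap x p q := by
  have h := hx (Fin.zero_le (Fin.last m))
  refine le_min ?_ ?_
  · rw [nextKnot]
    split_ifs with h1
    · linarith [hx (show q ≤ ⟨(q : ℕ) + 1, h1⟩ from Fin.mk_le_mk.2 (by simp))]
    · linarith [hx (Fin.le_last q)]
  · rw [prevKnot]
    split_ifs with h1
    · linarith [hx (Fin.zero_le p)]
    · linarith [hx (show (⟨(p : ℕ) - 1, by omega⟩ : Fin (m + 1)) ≤ p from Fin.mk_le_mk.2 (by simp))]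

/-- For each scale `u` there is a maximal block of knots of length less than `u` containing a given
one. -/
theorem exists_maximal_block (hx : Monotone x) {J J' : Fin (m + 1)} {u : ℝ}
    (hJ : x J' - x J < u) (hJJ : J ≤ J') (hu : u ≤ 2 * (x (Fin.last m) - x 0)) :
    ∃ p q : Fin (m + 1), p ≤ J ∧ J' ≤ q ∧ x q - x p < u ∧ u ≤ knotGap x p q := by
  classical
  set s : Finset (Fin (m + 1) × Fin (m + 1)) :=
    Finset.univ.filter fun pq => pq.1 ≤ J ∧ J' ≤ pq.2 ∧ x pq.2 - x pq.1 < u with hs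
  obtain ⟨⟨p, q⟩, hpq, hmax⟩ := s.exists_max_image (fun pq => (pq.2 : ℕ) + m - pq.1)
    ⟨(J, J'), by simp [hs, hJ]⟩
  simp only [hs, Finset.mem_filter, Finset.mem_univ, true_and, and_imp, Prod.forall] at hpq hmax
  obtain ⟨h1, h2, h3⟩ := hpq
  have hpm := p.2
  have hp' : ∀ p' : Fin (m + 1), (p' : ℕ) + 1 = p → u ≤ x q - x p' := by
    intro p' hp'
    by_contra hlt
    have := hmax p' q (Fin.le_def.2 (by have := Fin.le_def.1 h1; omega)) h2 (not_le.1 hlt)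
    omega
  have hq' : ∀ q' : Fin (m + 1), (q' : ℕ) = q + 1 → u ≤ x q' - x p := by
    intro q' hq'
    by_contra hlt
    have := hmax p q' h1 (Fin.le_def.2 (by have := Fin.le_def.1 h2; omega)) (not_le.1 hlt)
    omega
  refine ⟨p, q, h1, h2, h3, le_min ?_ ?_⟩
  · rw [nextKnot]
    split_ifs with h
    · exact hq' _ rfl
    · have hq : q = Fin.last m := Fin.ext (by simp; omega)
      rcases Nat.eq_zero_or_pos p with h0 | h0
      · rw [show p = 0 from Fin.ext h0]; linarith
      · have := hp' ⟨p - 1, by omega⟩ (by simp; omega)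
        have hxq : x q = x (Fin.last m) := congrArg x hq
        linarith [hx (Fin.zero_le (⟨p - 1, by omega⟩ : Fin (m + 1))), hx (Fin.le_last p)]
  · rw [prevKnot]
    split_ifs with h
    · rcases Nat.lt_or_ge (q + 1) (m + 1) with h0 | h0
      · have := hq' ⟨q + 1, h0⟩ rfl
        linarith [hx (Fin.le_last (⟨q + 1, h0⟩ : Fin (m + 1))), hx (Fin.zero_le p),
          hx (Fin.zero_le q)]
      · rw [show q = Fin.last m from Fin.ext (by simp; omega)]; linarith
    · exact hp' _ (by simp; omega)

/-- The weight at scale `u` is controlled by the factor of a maximal block. -/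
theorem knotWeight_extendKnots_le (hx : Monotone x) {j p q : Fin (m + 1)} {u : ℝ} (hu : 0 < u)
    (hpj : p ≤ j) (hjq : j ≤ q) (hpq : x p < x q) (hl : x q - x p ≤ u) :
    knotWeight (extendKnots x) r 0 m j u ≤
      2 ^ (m + 1) * (u ^ ((p : ℤ) + (r : ℤ) - (q : ℤ) - 1) /
        ((∏ i ∈ Finset.Iio p, (x q - x i)) * ∏ i ∈ Finset.Ioi q, (x i - x p))) := by
  have e0 : Finset.Icc 0 m = Finset.range (m + 1) := by
    ext i; simp only [Finset.mem_Icc, Finset.mem_range]; omega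
  have e1 : knotWeight (extendKnots x) r 0 m j u =
      u ^ r * ∏ i : Fin (m + 1), (max u |x i - x j|)⁻¹ := by
    rw [knotWeight, e0, Finset.prod_range]
    simp only [extendKnots_val]
  set c : Fin (m + 1) → ℝ := fun i =>
    if i < p then (x q - x i)⁻¹ else if q < i then (x i - x p)⁻¹ else u⁻¹ with hc
  have hle : ∏ i : Fin (m + 1), (max u |x i - x j|)⁻¹ ≤ ∏ i : Fin (m + 1), (2 * c i) := by
    refine Finset.prod_le_prod (fun i _ => by positivity) fun i _ => ?_
    have hxpj := hx hpj
    have hxjq := hx hjq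
    simp only [hc]
    split_ifs with h1 h2
    · have hi := hx h1.le
      rw [← div_eq_mul_inv, ← inv_div]
      have h3 := neg_le_abs (x i - x j)
      refine inv_anti₀ (by linarith) ?_
      rcases le_total u (|x i - x j|) with h | h
      · rw [max_eq_right h]; linarith
      · rw [max_eq_left h]; linarith
    · have hi := hx h2.le
      rw [← div_eq_mul_inv, ← inv_div]
      have h3 := le_abs_self (x i - x j)
      refine inv_anti₀ (by linarith) ?_
      rcases le_total u (|x i - x j|) with h | h
      · rw [max_eq_right h]; linarith
      · rw [max_eq_left h]; linarith
    · calc (max u |x i - x j|)⁻¹ ≤ u⁻¹ := inv_anti₀ hu (le_max_left _ _)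
        _ ≤ 2 * u⁻¹ := by linarith [inv_pos.2 hu]
  have hcard : ((Finset.univ.filter fun i : Fin (m + 1) => ¬ i < p).filter fun i => ¬ q < i) =
      Finset.Icc p q := by
    ext i; simp
  have hprod : ∏ i : Fin (m + 1), c i = (∏ i ∈ Finset.Iio p, (x q - x i))⁻¹ *
      ((∏ i ∈ Finset.Ioi q, (x i - x p))⁻¹ * u⁻¹ ^ ((q : ℕ) + 1 - p)) := by
    simp only [hc]
    rw [Finset.prod_ite, Finset.prod_ite, hcard, Finset.prod_const, Fin.card_Icc,
      Finset.prod_inv_distrib, Finset.prod_inv_distrib]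
    congr 3
    · ext i; simp
    · congr 1
      ext i
      simp only [Finset.mem_filter, Finset.mem_univ, true_and, Finset.mem_Ioi, not_lt]
      exact ⟨fun h => h.2, fun h => ⟨(hpj.trans hjq).trans h.le, h⟩⟩
  have hzpow : u ^ r * u⁻¹ ^ ((q : ℕ) + 1 - p) = u ^ ((p : ℤ) + (r : ℤ) - (q : ℤ) - 1) := by
    have hpq' : (p : ℕ) ≤ q := Fin.le_def.1 (hpj.trans hjq)
    rw [inv_pow, ← zpow_natCast, ← zpow_natCast, ← zpow_neg, ← zpow_add₀ hu.ne']
    congr 1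
    push_cast [Nat.cast_sub (show (p : ℕ) ≤ q + 1 by omega)]
    ring
  rw [e1]
  calc _ ≤ u ^ r * ∏ i : Fin (m + 1), (2 * c i) := by gcongr
    _ = 2 ^ (m + 1) * ((u ^ r * u⁻¹ ^ ((q : ℕ) + 1 - p)) *
        ((∏ i ∈ Finset.Iio p, (x q - x i))⁻¹ * (∏ i ∈ Finset.Ioi q, (x i - x p))⁻¹)) := by
        rw [Finset.prod_mul_distrib, hprod, Finset.prod_const, Finset.card_univ, Fintype.card_fin]
        ring
    _ = _ := by rw [hzpow, div_eq_mul_inv, mul_inv]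

theorem continuousOn_zpow_Ioi (n : ℤ) : ContinuousOn (fun u : ℝ => u ^ n) (Ioi 0) :=
  continuousOn_id.zpow₀ n fun _ hu => Or.inl hu.ne'

theorem knotSum_le_lambdaMax (hr : r + 1 ≤ m) (hx : Monotone x)
    (hmul : ∀ i j : Fin (m + 1), (j : ℕ) = (i : ℕ) + r + 1 → x i < x j) {φ : ℝ → ℝ}
    (hφ : Monotone φ) (hφ0 : ∀ u, 0 ≤ φ u) :
    knotSum φ (extendKnots x) r 0 m ≤
      (m - r : ℕ) * ((indexPairs m r).card * (2 ^ (m + 1) * lambdaMax hr x φ)) := by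
  have hz := isKnotSequence_extendKnots hx hmul
  set z := extendKnots x with hzdef
  have hz0 : z 0 = x 0 := extendKnots_val x 0
  have hzm : z m = x (Fin.last m) := extendKnots_val x (Fin.last m)
  set F : Fin (m + 1) × Fin (m + 1) → ℝ → ℝ := fun pq u =>
    φ u * (2 ^ (m + 1) * (u ^ ((pq.1 : ℤ) + (r : ℤ) - (pq.2 : ℤ) - 1) /
      ((∏ i ∈ Finset.Iio pq.1, (x pq.2 - x i)) * ∏ i ∈ Finset.Ioi pq.2, (x i - x pq.1)))) with hF
  have hpqlt (pq) (h : pq ∈ indexPairs m r) : x pq.1 < x pq.2 := by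
    simp only [indexPairs, Finset.mem_filter, Finset.mem_univ, true_and] at h
    have hlt : (pq.1 : ℕ) + r + 1 < m + 1 := h.trans_lt pq.2.2
    exact (hmul pq.1 ⟨pq.1 + r + 1, hlt⟩ rfl).trans_le (hx (Fin.le_def.2 h))
  have hden (pq) (h : pq ∈ indexPairs m r) :
      0 ≤ (∏ i ∈ Finset.Iio pq.1, (x pq.2 - x i)) * ∏ i ∈ Finset.Ioi pq.2, (x i - x pq.1) := by
    have hlt := hpqlt pq h
    refine mul_nonneg (Finset.prod_nonneg fun i hi => ?_) (Finset.prod_nonneg fun i hi => ?_)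
    · linarith [hx (Finset.mem_Iio.1 hi).le]
    · linarith [hx (Finset.mem_Ioi.1 hi).le]
  have hFint (pq) (h : pq ∈ indexPairs m r) :
      IntervalIntegrable (F pq) MeasureTheory.volume (x pq.2 - x pq.1) (knotGap x pq.1 pq.2) :=
    hφ.intervalIntegrable_mul
      (continuousOn_const.mul ((continuousOn_zpow_Ioi _).div_const _))
      (sub_pos.2 (hpqlt pq h)) (sub_le_knotGap hx _ _)
  have hF0 (pq) (h : pq ∈ indexPairs m r) {u : ℝ} (hu : 0 < u) : 0 ≤ F pq u :=
    mul_nonneg (hφ0 u) (mul_nonneg (by positivity) (div_nonneg (by positivity) (hden pq h)))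
  have hFI (pq) : ∫ u in (x pq.2 - x pq.1)..(knotGap x pq.1 pq.2), F pq u =
      2 ^ (m + 1) * lambdaPair r x φ pq.1 pq.2 := by
    rw [lambdaPair, ← intervalIntegral.integral_div, ← intervalIntegral.integral_const_mul]
    congr 1
    ext u
    simp only [hF]
    ring
  have hterm : ∀ j ∈ Finset.Ico 0 (m - r),
      ∫ u in (z (j + r + 1) - z j)..(2 * (z m - z 0)), φ u * knotWeight z r 0 m j u ≤
        (indexPairs m r).card * (2 ^ (m + 1) * lambdaMax hr x φ) := by
    intro j hj
    rw [Finset.mem_Ico] at hj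
    have hjm : j < m + 1 := by omega
    have hjm' : j + r + 1 < m + 1 := by omega
    set J : Fin (m + 1) := ⟨j, hjm⟩
    set J' : Fin (m + 1) := ⟨j + r + 1, hjm'⟩
    have hzj : z j = x J := extendKnots_val x J
    have hzj' : z (j + r + 1) = x J' := extendKnots_val x J'
    have hJlt : x J < x J' := hmul J J' rfl
    have hle : z (j + r + 1) - z j ≤ 2 * (z m - z 0) := by
      rw [hzj, hzj', hzm, hz0]
      linarith [hx (Fin.zero_le J), hx (Fin.le_last J')]
    have hpos : 0 < z (j + r + 1) - z j := by rw [hzj, hzj']; linarith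
    have hsetint (pq) (h : pq ∈ indexPairs m r) : MeasureTheory.IntegrableOn (F pq)
        (Ioc (x pq.2 - x pq.1) (knotGap x pq.1 pq.2)) :=
      (intervalIntegrable_iff_integrableOn_Ioc_of_le (sub_le_knotGap hx _ _)).1 (hFint pq h)
    have hindint (pq) (h : pq ∈ indexPairs m r) : MeasureTheory.Integrable
        ((Ioc (x pq.2 - x pq.1) (knotGap x pq.1 pq.2)).indicator (F pq)) :=
      (hsetint pq h).integrable_indicator measurableSet_Ioc
    rw [intervalIntegral.integral_of_le hle]
    calc _ ≤ ∫ u in Ioc (z (j + r + 1) - z j) (2 * (z m - z 0)), ∑ pq ∈ indexPairs m r,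
          (Ioc (x pq.2 - x pq.1) (knotGap x pq.1 pq.2)).indicator (F pq) u := by
          refine MeasureTheory.setIntegral_mono_on ?_ ?_ measurableSet_Ioc fun u hu => ?_
          · exact (intervalIntegrable_iff_integrableOn_Ioc_of_le hle).1
              (hφ.intervalIntegrable_mul (continuousOn_knotWeight _ _ _ _ _) hpos hle)
          · exact (MeasureTheory.integrable_finsetSum _ hindint).integrableOn
          · have hu0 : 0 < u := hpos.trans hu.1
            obtain ⟨p, q, h1, h2, h3, h4⟩ := exists_maximal_block hx (J := J) (J' := J') (u := u)
              (by rw [← hzj, ← hzj']; exact hu.1) (Fin.le_def.2 (by simp [J, J']; omega))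
              (by rw [← hzm, ← hz0]; exact hu.2)
            have hmem : (p, q) ∈ indexPairs m r := by
              simp only [indexPairs, Finset.mem_filter, Finset.mem_univ, true_and]
              have a1 := Fin.le_def.1 h1
              have a2 := Fin.le_def.1 h2
              simp only [J, J'] at a1 a2
              omega
            have hw := knotWeight_extendKnots_le (r := r) hx hu0 h1
              (le_trans (Fin.le_def.2 (by simp [J, J']; omega)) h2) (hpqlt _ hmem) h3.le
            calc φ u * knotWeight z r 0 m j u ≤ F (p, q) u := mul_le_mul_of_nonneg_left hw (hφ0 u)
              _ = (Ioc (x q - x p) (knotGap x p q)).indicator (F (p, q)) u :=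
                  (indicator_of_mem (show u ∈ Ioc _ _ from ⟨h3, h4⟩) _).symm
              _ ≤ _ := by
                  refine Finset.single_le_sum (f := fun pq : Fin (m + 1) × Fin (m + 1) =>
                    (Ioc (x pq.2 - x pq.1) (knotGap x pq.1 pq.2)).indicator (F pq) u)
                    (fun pq hpq => ?_) hmem
                  refine indicator_apply_nonneg fun _ => hF0 pq hpq hu0
      _ = ∑ pq ∈ indexPairs m r, ∫ u in Ioc (z (j + r + 1) - z j) (2 * (z m - z 0)),
          (Ioc (x pq.2 - x pq.1) (knotGap x pq.1 pq.2)).indicator (F pq) u :=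
          MeasureTheory.integral_finsetSum _ fun pq hpq => (hindint pq hpq).integrableOn
      _ ≤ ∑ pq ∈ indexPairs m r, 2 ^ (m + 1) * lambdaMax hr x φ := by
          refine Finset.sum_le_sum fun pq hpq => ?_
          have hnn : ∀ u, 0 ≤ (Ioc (x pq.2 - x pq.1) (knotGap x pq.1 pq.2)).indicator (F pq) u :=
            fun u => indicator_apply_nonneg fun hu =>
              hF0 pq hpq ((sub_pos.2 (hpqlt pq hpq)).trans hu.1)
          calc _ ≤ ∫ u, (Ioc (x pq.2 - x pq.1) (knotGap x pq.1 pq.2)).indicator (F pq) u :=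
                MeasureTheory.setIntegral_le_integral (hindint pq hpq)
                  (Filter.Eventually.of_forall hnn)
            _ = 2 ^ (m + 1) * lambdaPair r x φ pq.1 pq.2 := by
                rw [MeasureTheory.integral_indicator measurableSet_Ioc,
                  ← intervalIntegral.integral_of_le (sub_le_knotGap hx _ _), hFI]
            _ ≤ _ := by
                gcongr
                exact Finset.le_sup' (fun pq : Fin (m + 1) × Fin (m + 1) =>
                  lambdaPair r x φ pq.1 pq.2) hpq
      _ = _ := by rw [Finset.sum_const, nsmul_eq_mul]
  calc _ ≤ ∑ j ∈ Finset.Ico 0 (m - r),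
        (indexPairs m r).card * (2 ^ (m + 1) * lambdaMax hr x φ) := Finset.sum_le_sum hterm
    _ = _ := by rw [Finset.sum_const, nsmul_eq_mul, Nat.card_Ico, Nat.sub_zero]

end

theorem lambdaMax_nonneg {m r : ℕ} (hr : r + 1 ≤ m) {x : Fin (m + 1) → ℝ} (hx : Monotone x)
    {φ : ℝ → ℝ} (hφ0 : ∀ u, 0 ≤ φ u) : 0 ≤ lambdaMax hr x φ := by
  have h0 := hx (Fin.zero_le (Fin.last m))
  refine le_trans ?_ (Finset.le_sup' (fun pq : Fin (m + 1) × Fin (m + 1) =>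
    lambdaPair r x φ pq.1 pq.2) (show ((0 : Fin (m + 1)), Fin.last m) ∈ indexPairs m r by
      simp [indexPairs]; omega))
  refine div_nonneg (intervalIntegral.integral_nonneg (sub_le_knotGap hx _ _) fun u hu => ?_) ?_
  · have : 0 ≤ u := by linarith [hu.1]
    exact mul_nonneg (by positivity) (hφ0 u)
  · refine mul_nonneg (Finset.prod_nonneg fun i _ => ?_) (Finset.prod_nonneg fun i _ => ?_)
    · linarith [hx (Fin.le_last i)]
    · linarith [hx (Fin.zero_le i)]

/-- The estimate with a constant depending on `m` and `r`. -/
theorem exists_abs_dividedDifference_le (m r : ℕ) :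
    ∃ c : ℝ, 0 < c ∧
      ∀ (hr : r + 1 ≤ m) (x : Fin (m + 1) → ℝ), Monotone x →
        (∀ i j : Fin (m + 1), (j : ℕ) = (i : ℕ) + r + 1 → x i < x j) →
        ∀ f : ℝ → ℝ, ContDiffOn ℝ (r : ℕ) f (Icc (x 0) (x (Fin.last m))) →
          |dividedDifference (Icc (x 0) (x (Fin.last m))) f m x| ≤
            c * lambdaMax hr x
              (fun t => modulusOfSmoothness (m - r)
                (iteratedDerivWithin r f (Icc (x 0) (x (Fin.last m))))
                (x 0) (x (Fin.last m)) t) := by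
  rcases Nat.lt_or_ge m (r + 1) with hlt | hr
  · exact ⟨1, one_pos, fun hr => absurd hr (by omega)⟩
  obtain ⟨l, rfl⟩ : ∃ l, m = r + 1 + l := ⟨m - (r + 1), by omega⟩
  set m := r + 1 + l with hm
  obtain ⟨W, hW, HW⟩ := exists_isLocalApprox (k := m - r) (by omega)
  obtain ⟨K, hK, HK⟩ := exists_abs_windowDifference_le r (m - r) l hW.le
  have hcard : 0 < (indexPairs m r).card := Finset.card_pos.2 (indexPairs_nonempty hr)
  have hmr : 0 < m - r := by omega
  refine ⟨K * ((m - r : ℕ) * ((indexPairs m r).card * 2 ^ (m + 1))), by positivity, ?_⟩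
  intro hr x hx hmul f hf
  have hz := isKnotSequence_extendKnots hx hmul
  have hlt : x 0 < x (Fin.last m) :=
    (hmul 0 ⟨r + 1, by omega⟩ (by simp)).trans_le (hx (Fin.le_last _))
  obtain ⟨P, hP, hPd⟩ := HW r f (x 0) (x (Fin.last m)) hlt hf
  have hS : UniqueDiffOn ℝ (Icc (x 0) (x (Fin.last m))) := uniqueDiffOn_Icc hlt
  have h1 := HK _ f _ _ P m _ hP hz 0 (by omega)
  rw [← hm, zero_add] at h1
  have hz0 : extendKnots x 0 = x 0 := extendKnots_val x 0
  have hzm : extendKnots x m = x (Fin.last m) := extendKnots_val x (Fin.last m)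
  set Q := P (extendKnots x 0) (extendKnots x m) with hQ
  have hQd : Q.natDegree < m := by
    have := hPd (x 0) (x (Fin.last m)) le_rfl hlt le_rfl
    rw [hQ, hz0, hzm]
    omega
  have hxS (i) : x i ∈ Icc (x 0) (x (Fin.last m)) := ⟨hx (Fin.zero_le _), hx (Fin.le_last _)⟩
  have h2 : windowDifference (Icc (x 0) (x (Fin.last m))) (fun t => f t - Q.eval t)
      (extendKnots x) 0 m = dividedDifference (Icc (x 0) (x (Fin.last m))) f m x := by
    unfold windowDifference
    simp only [zero_add, extendKnots_val]
    rw [dividedDifference_sub hS hf Q.contDiff_eval.contDiffOn hx hxS hmul,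
      dividedDifference_polynomial hS Q hQd.le hx hxS, coeff_eq_zero_of_natDegree_lt hQd, sub_zero]
  rw [h2] at h1
  refine h1.trans ?_
  have h3 := knotSum_le_lambdaMax hr hx hmul hP.mono hP.nonneg
  calc _ ≤ K * _ := mul_le_mul_of_nonneg_left h3 hK.le
    _ = _ := by ring

theorem theorem1 (m : ℕ) :
    ∃ c : ℝ, 0 < c ∧
      ∀ (r : ℕ) (hr : r + 1 ≤ m) (x : Fin (m + 1) → ℝ), Monotone x →
        (∀ i j : Fin (m + 1), (j : ℕ) = (i : ℕ) + r + 1 → x i < x j) →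
        ∀ f : ℝ → ℝ, ContDiffOn ℝ (r : ℕ) f (Icc (x 0) (x (Fin.last m))) →
          |dividedDifference (Icc (x 0) (x (Fin.last m))) f m x| ≤
            c * lambdaMax hr x
              (fun t => modulusOfSmoothness (m - r)
                (iteratedDerivWithin r f (Icc (x 0) (x (Fin.last m))))
                (x 0) (x (Fin.last m)) t) := by
  choose c hc H using exists_abs_dividedDifference_le m
  refine ⟨1 + ∑ r ∈ Finset.range m, c r, ?_, fun r hr x hx hmul f hf => ?_⟩
  · have := Finset.sum_nonneg fun r (_ : r ∈ Finset.range m) => (hc r).le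
    linarith
  · refine (H r hr x hx hmul f hf).trans ?_
    refine mul_le_mul_of_nonneg_right ?_ (lambdaMax_nonneg hr hx modulusOfSmoothness_nonneg)
    have := Finset.single_le_sum (fun i _ => (hc i).le) (Finset.mem_range.2 hr)
    linarith
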